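/- Let $K$ be a field of characteristic $0$, let $A := K[[t_1]] \otimes_K K[[t_2]]$, let $\mathfrak{a} \subseteq A$ be the ideal generated by $t_1$ and $t_2$ (that is, by $t_1 \otimes 1$ and $1 \otimes t_2$), and let $\widehat{A} := \varprojlim_k A/\mathfrak{a}^k$ be the $\mathfrak{a}$-adic completion of $A$. Then: 1. The ideal $\mathfrak{a}$ is weakly proregular. (That is, $\mathfrak{a}$ is generated by some finite sequence $\mathbf{a} = (a_1, \dots, a_n)$ such that, with $\mathrm{K}(A; \mathbf{a}^k)$ the Koszul complex of $(a_1^k, \dots, a_n^k)$, for every $i > 0$ and $k \geq 1$ there is $l \geq k$ for which the canonical homomorphism $\mathrm{H}_i(\mathrm{K}(A; \mathbf{a}^{l})) \to \mathrm{H}_i(\mathrm{K}(A; \mathbf{a}^{k}))$ is zero.) 2. The ring $A$ is not noetherian. 3. There is an isomorphism of $K$-algebras $\widehat{A} \cong K[[t_1, t_2]]$ under which the image of $f(t_1) \otimes g(t_2) \in A$ corresponds to the power series $f(t_1)\, g(t_2)$; and the ring $\widehat{A}$ is noetherian. 4. The $A$-module $\widehat{A}$ is $\mathfrak{a}$-adically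 flat. (That is, $\operatorname{Tor}^A_i(N, \widehat{A}) = 0$ for every $i > 0$ and every $A$-module $N$ each of whose elements is annihilated by some power of $\mathfrak{a}$.) 5. The $A$-module $\widehat{A}$ is not flat. 6. Let $B := K[[t]]$, and let $I$ be the kernel of the ring homomorphism $A \to B$, $f(t_1) \otimes g(t_2) \mapsto f(t)\, g(t)$. Then $I/I^2 \cong \Omega^1_{B/K}$, linearly over $A \to B$, and the $B$-module $\Omega^1_{B/K}$ is not finitely generated. -/

import Mathlib

open CategoryTheory TensorProduct

universe u

namespace AdicFlatness

noncomputable section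

section Koszul

variable {A : Type u} [CommRing A] {n : ℕ}

/-- The linear functional `A ^ n → A` sending the `i`-th basis vector to `a i`. -/
def koszulFunctional (a : Fin n → A) : Module.Dual A (Fin n → A) :=
  Fintype.linearCombination A a

lemma contractLeft_mem (d : Module.Dual A (Fin n → A)) (i : ℕ) :
    ∀ x : ExteriorAlgebra A (Fin n → A), x ∈ ⋀[A]^(i + 1) (Fin n → A) →
      CliffordAlgebra.contractLeft (Q := 0) d x ∈ ⋀[A]^i (Fin n → A) := by
  induction i with
  | zero =>
    intro x hx
    rw [ExteriorAlgebra.exteriorPower, zero_add, pow_one] at hx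
    obtain ⟨v, rfl⟩ := hx
    rw [ExteriorAlgebra.exteriorPower, pow_zero]
    erw [CliffordAlgebra.contractLeft_ι]
    exact Submodule.algebraMap_mem _
  | succ i ih =>
    intro x hx
    rw [ExteriorAlgebra.exteriorPower, pow_succ'] at hx
    refine Submodule.mul_induction_on hx ?_ ?_
    · rintro _ ⟨v, rfl⟩ y hy
      erw [CliffordAlgebra.contractLeft_ι_mul]
      refine Submodule.sub_mem _ (Submodule.smul_mem _ _ hy) ?_
      rw [ExteriorAlgebra.exteriorPower, pow_succ']
      exact Submodule.mul_mem_mul ⟨v, rfl⟩ (ih y hy)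
    · intro x y hx hy
      rw [map_add]
      exact Submodule.add_mem _ hx hy

/-- The Koszul differential `⋀^(i+1) (A ^ n) → ⋀^i (A ^ n)` attached to `a_1, …, a_n`, namely
`e_{j_0} ∧ ⋯ ∧ e_{j_i} ↦ ∑ₗ (-1)^l a_{j_l} • e_{j_0} ∧ ⋯ (omit e_{j_l}) ⋯ ∧ e_{j_i}`:
the contraction with the functional `e_j ↦ a_j`. -/
def koszulD (a : Fin n → A) (i : ℕ) :
    ⋀[A]^(i + 1) (Fin n → A) →ₗ[A] ⋀[A]^i (Fin n → A) :=
  (CliffordAlgebra.contractLeft (Q := 0) (koszulFunctional a)).restrict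
    (contractLeft_mem (koszulFunctional a) i)

lemma koszulD_comp (a : Fin n → A) (i : ℕ) : koszulD a i ∘ₗ koszulD a (i + 1) = 0 := by
  ext1
  ext m
  exact CliffordAlgebra.contractLeft_contractLeft _ _

/-- The Koszul complex of the sequence `a`, with `⋀^i (A ^ n)` in homological degree `i`
(that is, in cohomological degree `-i`). -/
def koszul (a : Fin n → A) : ChainComplex (ModuleCat.{u} A) ℕ :=
  ChainComplex.of (fun i => ModuleCat.of A (⋀[A]^i (Fin n → A)))
    (fun i => ModuleCat.ofHom (koszulD a i))
    (fun i => by rw [← ModuleCat.ofHom_comp, koszulD_comp]; rfl)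

lemma koszul_d (a : Fin n → A) (i : ℕ) :
    (koszul a).d (i + 1) i = ModuleCat.ofHom (koszulD a i) :=
  ChainComplex.of_d (fun i => ModuleCat.of A (⋀[A]^i (Fin n → A)))
    (fun i => ModuleCat.ofHom (koszulD a i)) i

/-- The diagonal endomorphism `e_j ↦ c_j • e_j` of `A ^ n`. -/
def diagMap (c : Fin n → A) : (Fin n → A) →ₗ[A] (Fin n → A) :=
  LinearMap.pi fun j => c j • LinearMap.proj j

lemma koszulFunctional_diagMap (b c : Fin n → A) (v : Fin n → A) :
    koszulFunctional b (diagMap c v) = koszulFunctional (fun j => c j * b j) v := by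
  simp only [koszulFunctional, diagMap, Fintype.linearCombination_apply, LinearMap.pi_apply,
    LinearMap.smul_apply, LinearMap.proj_apply, smul_eq_mul]
  exact Finset.sum_congr rfl fun j _ => by ring

lemma contractLeft_map (b c : Fin n → A) (x : ExteriorAlgebra A (Fin n → A)) :
    CliffordAlgebra.contractLeft (Q := 0) (koszulFunctional b)
        (ExteriorAlgebra.map (diagMap c) x) =
      ExteriorAlgebra.map (diagMap c)
        (CliffordAlgebra.contractLeft (Q := 0) (koszulFunctional fun j => c j * b j) x) := by
  induction x using CliffordAlgebra.left_induction with
  | algebraMap r =>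
    erw [AlgHom.commutes, CliffordAlgebra.contractLeft_algebraMap,
      CliffordAlgebra.contractLeft_algebraMap, map_zero]
  | add x y hx hy => simp only [map_add, hx, hy]
  | ι_mul x v hx =>
    have h (y : ExteriorAlgebra A (Fin n → A)) :
        ExteriorAlgebra.map (diagMap c) (CliffordAlgebra.ι 0 v * y) =
          CliffordAlgebra.ι 0 (diagMap c v) * ExteriorAlgebra.map (diagMap c) y :=
      (map_mul (ExteriorAlgebra.map (diagMap c)) _ _).trans
        (congrArg (· * _) (ExteriorAlgebra.map_apply_ι _ _))
    rw [h, CliffordAlgebra.contractLeft_ι_mul, CliffordAlgebra.contractLeft_ι_mul, map_sub,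
      map_smul, h, hx, koszulFunctional_diagMap]

lemma coe_map (f : (Fin n → A) →ₗ[A] (Fin n → A)) (i : ℕ) (x : ⋀[A]^i (Fin n → A)) :
    (exteriorPower.map i f x : ExteriorAlgebra A (Fin n → A)) =
      ExteriorAlgebra.map f (x : ExteriorAlgebra A (Fin n → A)) := by
  have h : (Submodule.subtype _) ∘ₗ exteriorPower.map i f =
      (ExteriorAlgebra.map f).toLinearMap ∘ₗ (Submodule.subtype (⋀[A]^i (Fin n → A))) := by
    ext m
    simp [ExteriorAlgebra.map_apply_ιMulti]
  exact LinearMap.congr_fun h x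

lemma koszulD_map (a b c : Fin n → A) (h : ∀ j, c j * b j = a j) (i : ℕ) :
    koszulD b i ∘ₗ exteriorPower.map (i + 1) (diagMap c) =
      exteriorPower.map i (diagMap c) ∘ₗ koszulD a i := by
  obtain rfl : (fun j => c j * b j) = a := funext h
  refine LinearMap.ext fun x => Subtype.ext ?_
  rw [LinearMap.comp_apply, LinearMap.comp_apply, coe_map]
  simp only [koszulD, LinearMap.coe_restrict_apply, coe_map]
  exact contractLeft_map b c x

/-- The morphism of Koszul complexes (induced by `e_j ↦ c_j • e_j`) from the Koszul complex of
`(c_1 b_1, …, c_n b_n)` to the Koszul complex of `(b_1, …, b_n)`. -/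
def koszulMap (a b c : Fin n → A) (h : ∀ j, c j * b j = a j) : koszul a ⟶ koszul b :=
  ChainComplex.ofHom
    (fun i => ModuleCat.ofHom (exteriorPower.map i (diagMap c)))
    (fun i => by
      rw [koszul_d, koszul_d]
      exact (ModuleCat.ofHom_comp _ _).symm.trans
        ((congrArg ModuleCat.ofHom (koszulD_map a b c h i)).trans (ModuleCat.ofHom_comp _ _)))

/-- The transition morphism `K(A; a^l) ⟶ K(A; a^k)` for `k ≤ l`, which is
`e_j ↦ a_j ^ (l - k) • e_j` in degree one. -/
def koszulTransition (a : Fin n → A) {k l : ℕ} (h : k ≤ l) :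
    koszul (fun j => a j ^ l) ⟶ koszul (fun j => a j ^ k) :=
  koszulMap _ _ (fun j => a j ^ (l - k)) fun j => pow_sub_mul_pow (a j) h

/-- A finite sequence is weakly proregular if, for every `i > 0`, the inverse system of
`i`-th homology modules of the Koszul complexes `K(A; a^k)`, `k ≥ 1`, is pro-zero. -/
def IsWeaklyProregularSeq (a : Fin n → A) : Prop :=
  ∀ i : ℕ, 0 < i → ∀ k : ℕ, 1 ≤ k → ∃ l : ℕ, ∃ h : k ≤ l,
    HomologicalComplex.homologyMap (koszulTransition a h) i = 0

/-- An ideal is weakly proregular if it is generated by some weakly proregular sequence. -/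
def IsWeaklyProregular (I : Ideal A) : Prop :=
  ∃ (n : ℕ) (a : Fin n → A), Ideal.span (Set.range a) = I ∧ IsWeaklyProregularSeq a

end Koszul

/-- `N` is an `I`-torsion module: each element is annihilated by some power of `I`. -/
def IsIdealTorsion {A : Type u} [CommRing A] (I : Ideal A)
    (N : Type u) [AddCommGroup N] [Module A N] : Prop :=
  ∀ x : N, ∃ k : ℕ, ∀ r ∈ I ^ k, r • x = 0

/-- `M` is `I`-adically flat: `Tor_i (N, M) = 0` for all `i > 0` and all `I`-torsion modules
`N`. -/
def IsAdicallyFlat {A : Type u} [CommRing A] (I : Ideal A)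
    (M : Type u) [AddCommGroup M] [Module A M] : Prop :=
  ∀ N : ModuleCat.{u} A, IsIdealTorsion I N → ∀ i : ℕ, 0 < i →
    Limits.IsZero (((Tor (ModuleCat.{u} A) i).obj N).obj (ModuleCat.of A M))

/-- The ring `K⟦t₁⟧ ⊗[K] K⟦t₂⟧`. -/
abbrev TensorPow (K : Type u) [Field K] : Type u := PowerSeries K ⊗[K] PowerSeries K

/-- The ideal `(t₁, t₂)` of `K⟦t₁⟧ ⊗[K] K⟦t₂⟧`. -/
def varIdeal (K : Type u) [Field K] : Ideal (TensorPow K) :=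
  Ideal.span {PowerSeries.X ⊗ₜ[K] 1, 1 ⊗ₜ[K] PowerSeries.X}

/-- The ideal `I` of `K⟦t₁⟧ ⊗[K] K⟦t₂⟧`: the kernel of the `K`-algebra homomorphism to `K⟦t⟧`
with `f ⊗ g ↦ f g`, that is, `f(t₁) ⊗ g(t₂) ↦ f(t) g(t)`. -/
def diagIdeal (K : Type u) [Field K] : Ideal (TensorPow K) :=
  RingHom.ker (Algebra.TensorProduct.lmul' K (S := PowerSeries K))

end

end AdicFlatness

namespace AdicFlatness

noncomputable section

/-! ### The completion of `K⟦t₁⟧ ⊗ K⟦t₂⟧` is a power series ring -/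

section Completion

/-! Write A, 𝔞, Â, B, I as in the theorem, and map A to K⟦X₀, X₁⟧ by `toMv`. An element of A lies in
𝔞ⁿ exactly when its image has order at least n (`mem_varIdeal_pow_iff`), and every polynomial is in
the image; so is K⟦X₀, X₁⟧, which is noetherian.

The pair (t₁, t₂) is regular on A, because A ⧸ (t₁) is K ⊗ K⟦t₂⟧ and everything is flat over K; it
is also regular on K⟦X₀, X₁⟧. Regularity on A makes the Koszul complexes of all powers acyclic in
positive degrees, hence weak proregularity. Regularity on both kills Tor_i(A ⧸ 𝔞, Â) for i > 0,
through the short exact sequences of multiplication by t₁ and then by t₂. As A ⧸ 𝔞 is a field,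
filtering by powers of 𝔞 and passing to finitely generated submodules extends the vanishing to all
torsion modules.

The negative statements rest on Ω = Ω¹_{B/K} = I/I² not being finitely generated. The series
exp(tⁿ), n ≥ 1, are algebraically independent over K (`algebraicIndependent_expPow`), so in
characteristic zero their differentials are linearly independent over Frac B, hence over B in Ω. If
A were noetherian, I and then I/I² would be finitely generated. If were flat, Ω would be generated
by dt (`D_mem_span_of_flat`): f(X₁) − f(X₀) is a multiple of X₁ − X₀ in K⟦X₀, X₁⟧, and the
equational criterion turns this into c(1⊗f − f⊗1) + d(1⊗t − t⊗1) = 0 in A with c of nonzero constant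
term. Modulo I² this reads c̄ df + d̄ dt = 0 with c̄ a unit of B. -/

lemma factorPow_evalₐ {R : Type*} [CommRing R] (I : Ideal R) {m n : ℕ} (h : m ≤ n)
    (x : AdicCompletion I R) :
    Ideal.Quotient.factorPow I h (AdicCompletion.evalₐ I n x) = AdicCompletion.evalₐ I m x := by
  obtain ⟨x, rfl⟩ := AdicCompletion.mk_surjective I R x
  rw [AdicCompletion.evalₐ_mk, AdicCompletion.evalₐ_mk]
  exact AdicCompletion.Ideal.mk_eq_mk I h x

open PowerSeries (X)

variable {K : Type u} [Field K]

/-- The exponent `(i, j)` of the monomial `X₀ ^ i * X₁ ^ j`. -/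
def expPair (i j : ℕ) : Fin 2 →₀ ℕ := Finsupp.equivFunOnFinite.symm ![i, j]

@[simp] lemma expPair_zero (i j : ℕ) : expPair i j 0 = i := rfl

@[simp] lemma expPair_one (i j : ℕ) : expPair i j 1 = j := rfl

lemma expPair_eta (m : Fin 2 →₀ ℕ) : expPair (m 0) (m 1) = m := by
  ext i; fin_cases i <;> rfl

lemma degree_eq_add (m : Fin 2 →₀ ℕ) : m.degree = m 0 + m 1 := by
  rw [Finsupp.degree_eq_sum, Fin.sum_univ_two]

/-- The power series `f(X₀) g(X₁)`. -/
def outer (f g : PowerSeries K) : MvPowerSeries (Fin 2) K :=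
  fun m => PowerSeries.coeff (m 0) f * PowerSeries.coeff (m 1) g

lemma coeff_outer (f g : PowerSeries K) (m : Fin 2 →₀ ℕ) :
    MvPowerSeries.coeff m (outer f g) =
      PowerSeries.coeff (m 0) f * PowerSeries.coeff (m 1) g := rfl

lemma outer_mul (f f' g g' : PowerSeries K) :
    outer (f * f') (g * g') = outer f g * outer f' g' := by
  classical
  ext m
  rw [coeff_outer, MvPowerSeries.coeff_mul, PowerSeries.coeff_mul, PowerSeries.coeff_mul,
    Finset.sum_mul_sum, ← Finset.sum_product']
  refine Finset.sum_nbij' (fun p => (expPair p.1.1 p.2.1, expPair p.1.2 p.2.2))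
    (fun q => ((q.1 0, q.2 0), (q.1 1, q.2 1))) ?_ ?_ ?_ ?_ ?_
  · rintro ⟨⟨a, b⟩, ⟨c, d⟩⟩ h
    simp only [Finset.mem_product, Finset.HasAntidiagonal.mem_antidiagonal] at h ⊢
    ext i; fin_cases i
    · exact h.1
    · exact h.2
  · rintro ⟨a, b⟩ h
    simp only [Finset.mem_product, Finset.HasAntidiagonal.mem_antidiagonal] at h ⊢
    subst h
    exact ⟨rfl, rfl⟩
  · rintro ⟨⟨a, b⟩, ⟨c, d⟩⟩ _
    rfl
  · rintro ⟨a, b⟩ _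
    simp only [expPair_eta]
  · rintro ⟨⟨a, b⟩, ⟨c, d⟩⟩ _
    simp only [coeff_outer, expPair_zero, expPair_one]
    ring

lemma outer_one : outer (1 : PowerSeries K) 1 = 1 := by
  classical
  ext m
  rw [coeff_outer, MvPowerSeries.coeff_one, PowerSeries.coeff_one, PowerSeries.coeff_one,
    ite_zero_mul_ite_zero, one_mul]
  refine if_congr ⟨fun h => ?_, fun h => by simp [h]⟩ rfl rfl
  rw [← expPair_eta m, h.1, h.2]
  ext i; fin_cases i <;> rfl

variable (K) in
/-- The `K`-linear map `f ⊗ g ↦ f(X₀) g(X₁)`. -/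
def toMvLinear : TensorPow K →ₗ[K] MvPowerSeries (Fin 2) K :=
  TensorProduct.lift <| LinearMap.mk₂ K outer
    (fun f f' g => by ext m; simp [coeff_outer, add_mul])
    (fun c f g => by ext m; simp [coeff_outer, mul_assoc])
    (fun f g g' => by ext m; simp [coeff_outer, mul_add])
    (fun c f g => by ext m; simp [coeff_outer, mul_left_comm])

variable (K) in
/-- The `K`-algebra homomorphism `K⟦t₁⟧ ⊗ K⟦t₂⟧ → K⟦X₀, X₁⟧`, `f ⊗ g ↦ f(X₀) g(X₁)`. -/
def toMv : TensorPow K →ₐ[K] MvPowerSeries (Fin 2) K :=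
  Algebra.TensorProduct.algHomOfLinearMapTensorProduct (toMvLinear K)
    (fun f f' g g' => outer_mul f f' g g') outer_one

lemma toMv_tmul (f g : PowerSeries K) : toMv K (f ⊗ₜ g) = outer f g := rfl

lemma X_tmul_one_mem : (X ⊗ₜ[K] 1 : TensorPow K) ∈ varIdeal K :=
  Ideal.subset_span (Set.mem_insert _ _)

lemma one_tmul_X_mem : (1 ⊗ₜ[K] X : TensorPow K) ∈ varIdeal K :=
  Ideal.subset_span (Set.mem_insert_of_mem _ rfl)

lemma X_pow_tmul_mem (n : ℕ) (f g : PowerSeries K) :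
    ((X ^ n * f) ⊗ₜ[K] g : TensorPow K) ∈ varIdeal K ^ n := by
  have h : ((X ^ n * f) ⊗ₜ[K] g : TensorPow K) = (X ⊗ₜ[K] 1) ^ n * (f ⊗ₜ[K] g) := by
    rw [Algebra.TensorProduct.tmul_pow, Algebra.TensorProduct.tmul_mul_tmul, one_pow, one_mul]
  rw [h]
  exact Ideal.mul_mem_right _ _ (Ideal.pow_mem_pow X_tmul_one_mem n)

lemma tmul_X_pow_mem (n : ℕ) (f g : PowerSeries K) :
    (f ⊗ₜ[K] (X ^ n * g) : TensorPow K) ∈ varIdeal K ^ n := by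
  have h : (f ⊗ₜ[K] (X ^ n * g) : TensorPow K) = (1 ⊗ₜ[K] X) ^ n * (f ⊗ₜ[K] g) := by
    rw [Algebra.TensorProduct.tmul_pow, Algebra.TensorProduct.tmul_mul_tmul, one_pow, one_mul]
  rw [h]
  exact Ideal.mul_mem_right _ _ (Ideal.pow_mem_pow one_tmul_X_mem n)

lemma X_pow_tmul_X_pow_mem {n i j : ℕ} (h : n ≤ i + j) :
    ((X ^ i) ⊗ₜ[K] (X ^ j) : TensorPow K) ∈ varIdeal K ^ n := by
  refine Ideal.pow_le_pow_right h ?_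
  have h : ((X ^ i) ⊗ₜ[K] (X ^ j) : TensorPow K) = (X ⊗ₜ[K] 1) ^ i * (1 ⊗ₜ[K] X) ^ j := by
    simp [Algebra.TensorProduct.tmul_pow, Algebra.TensorProduct.tmul_mul_tmul]
  rw [h]
  refine (pow_add (varIdeal K) i j).symm ▸ ?_
  exact Ideal.mul_mem_mul (Ideal.pow_mem_pow X_tmul_one_mem i) (Ideal.pow_mem_pow one_tmul_X_mem j)

variable (K) in
/-- The polynomial `∑_{i, j < n} c_{i j} t₁ ^ i t₂ ^ j`, for `c` the coefficients of a power
series. -/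
def truncTensor (n : ℕ) : MvPowerSeries (Fin 2) K →ₗ[K] TensorPow K :=
  ∑ i ∈ Finset.range n, ∑ j ∈ Finset.range n,
    (MvPowerSeries.coeff (expPair i j)).smulRight ((X ^ i) ⊗ₜ[K] (X ^ j))

lemma truncTensor_apply (n : ℕ) (p : MvPowerSeries (Fin 2) K) :
    truncTensor K n p = ∑ i ∈ Finset.range n, ∑ j ∈ Finset.range n,
      MvPowerSeries.coeff (expPair i j) p • ((X ^ i) ⊗ₜ[K] (X ^ j)) := by
  simp [truncTensor]

lemma coeff_toMv_truncTensor {n : ℕ} (p : MvPowerSeries (Fin 2) K) {m : Fin 2 →₀ ℕ}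
    (hm : m.degree < n) :
    MvPowerSeries.coeff m (toMv K (truncTensor K n p)) = MvPowerSeries.coeff m p := by
  have h0 : m 0 < n := by rw [degree_eq_add] at hm; omega
  have h1 : m 1 < n := by rw [degree_eq_add] at hm; omega
  simp only [truncTensor_apply, map_sum, map_smul, toMv_tmul, coeff_outer, smul_eq_mul,
    PowerSeries.coeff_X_pow]
  simp [Finset.sum_ite_eq, h0, h1, expPair_eta]

lemma eq_sum_add_X_pow_mul (f : PowerSeries K) (n : ℕ) :
    ∃ g, f = (∑ i ∈ Finset.range n, PowerSeries.coeff i f • X ^ i) + X ^ n * g := by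
  have h : X ^ n ∣ f - ∑ i ∈ Finset.range n, PowerSeries.coeff i f • (X : PowerSeries K) ^ i := by
    rw [PowerSeries.X_pow_dvd_iff]
    intro m hm
    simp [PowerSeries.coeff_X_pow, hm]
  obtain ⟨g, hg⟩ := h
  exact ⟨g, by rw [← hg]; ring⟩

/-- Truncating over the box i, j < n, rather than the triangle i + j < n, makes the truncation of a
pure tensor the tensor of the truncations F, G. With f = F + tⁿf' and g = G + tⁿg', the error is F ⊗
tⁿg' + tⁿf' ⊗ g. -/
lemma sub_truncTensor_mem (n : ℕ) (a : TensorPow K) :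
    a - truncTensor K n (toMv K a) ∈ varIdeal K ^ n := by
  induction a using TensorProduct.induction_on with
  | zero => simp
  | add a b ha hb =>
    have := add_mem ha hb
    rwa [map_add, map_add, add_sub_add_comm]
  | tmul f g =>
    obtain ⟨f', hf⟩ := eq_sum_add_X_pow_mul f n
    obtain ⟨g', hg⟩ := eq_sum_add_X_pow_mul g n
    have key : f ⊗ₜ[K] g - truncTensor K n (toMv K (f ⊗ₜ[K] g)) =
        (∑ i ∈ Finset.range n, PowerSeries.coeff i f • X ^ i) ⊗ₜ[K] (X ^ n * g') +
          (X ^ n * f') ⊗ₜ[K] g := by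
      have h2 : truncTensor K n (toMv K (f ⊗ₜ[K] g)) =
          (∑ i ∈ Finset.range n, PowerSeries.coeff i f • X ^ i) ⊗ₜ[K]
            (∑ i ∈ Finset.range n, PowerSeries.coeff i g • X ^ i) := by
        simp only [truncTensor_apply, toMv_tmul, coeff_outer, expPair_zero, expPair_one,
          TensorProduct.sum_tmul, TensorProduct.tmul_sum, TensorProduct.smul_tmul_smul]
        exact Finset.sum_comm
      set F := ∑ i ∈ Finset.range n, PowerSeries.coeff i f • (X : PowerSeries K) ^ i
      set G := ∑ i ∈ Finset.range n, PowerSeries.coeff i g • (X : PowerSeries K) ^ i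
      rw [h2]
      conv_lhs => rw [hf]
      rw [TensorProduct.add_tmul]
      conv_lhs => enter [1, 1]; rw [hg]
      rw [TensorProduct.tmul_add]
      abel
    rw [key]
    exact add_mem (tmul_X_pow_mem _ _ _) (X_pow_tmul_mem _ _ _)

lemma truncTensor_mem {n : ℕ} {p : MvPowerSeries (Fin 2) K}
    (hp : ∀ m : Fin 2 →₀ ℕ, m.degree < n → MvPowerSeries.coeff m p = 0) :
    truncTensor K n p ∈ varIdeal K ^ n := by
  rw [truncTensor_apply]
  refine sum_mem fun i _ => sum_mem fun j _ => ?_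
  by_cases h : i + j < n
  · rw [hp _ (by rwa [degree_eq_add]), zero_smul]
    exact zero_mem _
  · refine (Algebra.smul_def (R := K) (A := TensorPow K) _ _).symm ▸ ?_
    exact Ideal.mul_mem_left _ _ (X_pow_tmul_X_pow_mem (not_lt.mp h))

lemma coeff_mul_eq_zero {a b : ℕ} {p q : MvPowerSeries (Fin 2) K}
    (hp : ∀ m : Fin 2 →₀ ℕ, m.degree < a → MvPowerSeries.coeff m p = 0)
    (hq : ∀ m : Fin 2 →₀ ℕ, m.degree < b → MvPowerSeries.coeff m q = 0)
    (m : Fin 2 →₀ ℕ) (hm : m.degree < a + b) : MvPowerSeries.coeff m (p * q) = 0 := by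
  classical
  rw [MvPowerSeries.coeff_mul]
  refine Finset.sum_eq_zero fun x hx => ?_
  rw [Finset.HasAntidiagonal.mem_antidiagonal] at hx
  have : x.1.degree + x.2.degree = m.degree := by rw [← hx, map_add]
  rcases lt_or_ge x.1.degree a with h | h
  · rw [hp _ h, zero_mul]
  · rw [hq _ (by omega), mul_zero]

/-- Both generators have zero constant term, and lower bounds on orders add under multiplication. -/
lemma coeff_toMv_eq_zero_of_mem {n : ℕ} {a : TensorPow K} (ha : a ∈ varIdeal K ^ n) :
    ∀ m : Fin 2 →₀ ℕ, m.degree < n → MvPowerSeries.coeff m (toMv K a) = 0 := by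
  have h1 (b : TensorPow K) (hb : b ∈ varIdeal K) (m : Fin 2 →₀ ℕ) (hm : m.degree < 1) :
      MvPowerSeries.coeff m (toMv K b) = 0 := by
    have : varIdeal K ≤ RingHom.ker ((MvPowerSeries.constantCoeff).comp (toMv K).toRingHom) := by
      rw [varIdeal, Ideal.span_le]
      rintro _ (rfl | rfl)
      · change MvPowerSeries.coeff 0 (outer X 1) = 0
        simp [coeff_outer]
      · change MvPowerSeries.coeff 0 (outer 1 X) = 0
        simp [coeff_outer]
    obtain rfl : m = 0 := by rw [← Finsupp.degree_eq_zero_iff]; omega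
    exact this hb
  induction n generalizing a with
  | zero => intro m hm; omega
  | succ n ih =>
    have ha' : a ∈ varIdeal K ^ n * varIdeal K := pow_succ (varIdeal K) n ▸ ha
    clear ha
    induction ha' using Submodule.mul_induction_on' with
    | mem_mul_mem b hb c hc =>
      rw [map_mul]
      exact coeff_mul_eq_zero (ih hb) (h1 c hc)
    | add b _ c _ hb hc =>
      intro m hm
      rw [map_add, map_add, hb m hm, hc m hm, add_zero]

/-- The 𝔞-adic filtration is pulled back from the order filtration on power series: an element
differs from its truncation by an element of 𝔞ⁿ, and the truncation lies in 𝔞ⁿ once its terms of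
degree below n vanish. The identification of the completion rests on this; the case n = 1 shows that
𝔞 is maximal. -/
lemma mem_varIdeal_pow_iff (n : ℕ) (a : TensorPow K) :
    a ∈ varIdeal K ^ n ↔
      ∀ m : Fin 2 →₀ ℕ, m.degree < n → MvPowerSeries.coeff m (toMv K a) = 0 := by
  refine ⟨coeff_toMv_eq_zero_of_mem, fun h => ?_⟩
  have := add_mem (sub_truncTensor_mem n a) (truncTensor_mem h)
  rwa [sub_add_cancel] at this

lemma mk_eq_mk_iff (n : ℕ) (a b : TensorPow K) :
    Ideal.Quotient.mk (varIdeal K ^ n) a = Ideal.Quotient.mk (varIdeal K ^ n) b ↔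
      ∀ m : Fin 2 →₀ ℕ, m.degree < n →
        MvPowerSeries.coeff m (toMv K a) = MvPowerSeries.coeff m (toMv K b) := by
  rw [Ideal.Quotient.eq, mem_varIdeal_pow_iff]
  simp [sub_eq_zero]

lemma coeff_mul_congr {n : ℕ} {p p' q q' : MvPowerSeries (Fin 2) K}
    (hp : ∀ m : Fin 2 →₀ ℕ, m.degree < n → MvPowerSeries.coeff m p = MvPowerSeries.coeff m p')
    (hq : ∀ m : Fin 2 →₀ ℕ, m.degree < n → MvPowerSeries.coeff m q = MvPowerSeries.coeff m q')
    (m : Fin 2 →₀ ℕ) (hm : m.degree < n) :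
    MvPowerSeries.coeff m (p * q) = MvPowerSeries.coeff m (p' * q') := by
  classical
  rw [MvPowerSeries.coeff_mul, MvPowerSeries.coeff_mul]
  refine Finset.sum_congr rfl fun x hx => ?_
  rw [Finset.HasAntidiagonal.mem_antidiagonal] at hx
  have : x.1.degree + x.2.degree = m.degree := by rw [← hx, map_add]
  rw [hp _ (by omega), hq _ (by omega)]

variable (K) in
/-- The homomorphism `K⟦X₀, X₁⟧ → A / 𝔞 ^ n` sending a power series to the class of its
truncations. -/
def truncQuotient (n : ℕ) : MvPowerSeries (Fin 2) K →ₐ[K] TensorPow K ⧸ varIdeal K ^ n :=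
  AlgHom.ofLinearMap ((Ideal.Quotient.mkₐ K (varIdeal K ^ n)).toLinearMap ∘ₗ truncTensor K n)
    (by
      change Ideal.Quotient.mk _ _ = Ideal.Quotient.mk _ 1
      rw [mk_eq_mk_iff]
      intro m hm
      rw [coeff_toMv_truncTensor _ hm, map_one (toMv K)])
    (fun p q => by
      change Ideal.Quotient.mk _ _ = Ideal.Quotient.mk _ _ * Ideal.Quotient.mk _ _
      rw [← map_mul, mk_eq_mk_iff]
      intro m hm
      rw [coeff_toMv_truncTensor _ hm, map_mul (toMv K)]
      exact coeff_mul_congr (fun m hm => (coeff_toMv_truncTensor _ hm).symm)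
        (fun m hm => (coeff_toMv_truncTensor _ hm).symm) m hm)

lemma truncQuotient_apply (n : ℕ) (p : MvPowerSeries (Fin 2) K) :
    truncQuotient K n p = Ideal.Quotient.mk _ (truncTensor K n p) := rfl

lemma truncQuotient_eq_mk_iff (n : ℕ) (p : MvPowerSeries (Fin 2) K) (a : TensorPow K) :
    truncQuotient K n p = Ideal.Quotient.mk _ a ↔
      ∀ m : Fin 2 →₀ ℕ, m.degree < n →
        MvPowerSeries.coeff m p = MvPowerSeries.coeff m (toMv K a) := by
  rw [truncQuotient_apply, mk_eq_mk_iff]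
  exact forall₂_congr fun m hm => by rw [coeff_toMv_truncTensor _ hm]

lemma factorₐ_comp_truncQuotient {m n : ℕ} (hle : m ≤ n) :
    (Ideal.Quotient.factorₐ K (Ideal.pow_le_pow_right hle)).comp (truncQuotient K n) =
      truncQuotient K m := by
  ext p
  change Ideal.Quotient.mk _ _ = Ideal.Quotient.mk _ _
  rw [mk_eq_mk_iff]
  intro i hi
  rw [coeff_toMv_truncTensor _ hi, coeff_toMv_truncTensor _ (hi.trans_le hle)]

variable (K) in
/-- The canonical homomorphism from `K⟦X₀, X₁⟧` to the completion of `K⟦t₁⟧ ⊗ K⟦t₂⟧`. -/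
def mvToCompletion :
    MvPowerSeries (Fin 2) K →ₐ[K] AdicCompletion (varIdeal K) (TensorPow K) :=
  AdicCompletion.liftAlgHom (varIdeal K) (truncQuotient K) factorₐ_comp_truncQuotient

lemma evalₐ_mvToCompletion (n : ℕ) (p : MvPowerSeries (Fin 2) K) :
    AdicCompletion.evalₐ (varIdeal K) n (mvToCompletion K p) = truncQuotient K n p :=
  AdicCompletion.evalₐ_liftAlgHom _ _ factorₐ_comp_truncQuotient _ _

lemma mvToCompletion_toMv (a : TensorPow K) :
    mvToCompletion K (toMv K a) = algebraMap _ _ a := by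
  refine AdicCompletion.ext_evalₐ fun n => ?_
  rw [evalₐ_mvToCompletion, AdicCompletion.algebraMap_apply, AdicCompletion.evalₐ_of,
    truncQuotient_eq_mk_iff]
  exact fun _ _ => rfl

lemma mvToCompletion_injective : Function.Injective (mvToCompletion K) := by
  refine (injective_iff_map_eq_zero _).mpr fun p hp => ?_
  ext m
  have h : truncQuotient K (m.degree + 1) p = Ideal.Quotient.mk _ 0 := by
    rw [← evalₐ_mvToCompletion, hp, map_zero, map_zero]
  rw [truncQuotient_eq_mk_iff] at h
  rw [h m (Nat.lt_succ_self _), map_zero]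

lemma mvToCompletion_surjective : Function.Surjective (mvToCompletion K) := by
  intro x
  choose a ha using fun n => Ideal.Quotient.mk_surjective (AdicCompletion.evalₐ (varIdeal K) n x)
  -- A coefficient of degree d is determined modulo 𝔞 ^ (d + 1), so it is read off from the
  -- representative at that level.
  let p : MvPowerSeries (Fin 2) K :=
    fun m => MvPowerSeries.coeff m (toMv K (a (m.degree + 1)))
  refine ⟨p, AdicCompletion.ext_evalₐ fun n => ?_⟩
  rw [evalₐ_mvToCompletion, ← ha, truncQuotient_eq_mk_iff]
  intro m hm
  change MvPowerSeries.coeff m (toMv K (a (m.degree + 1))) = _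
  have h : Ideal.Quotient.mk (varIdeal K ^ (m.degree + 1)) (a n) =
      Ideal.Quotient.mk (varIdeal K ^ (m.degree + 1)) (a (m.degree + 1)) := by
    rw [ha, ← factorPow_evalₐ _ hm, ← ha n]
    rfl
  exact ((mk_eq_mk_iff _ _ _).mp h m (Nat.lt_succ_self _)).symm

variable (K) in
/-- The completion of `K⟦t₁⟧ ⊗ K⟦t₂⟧` is `K⟦X₀, X₁⟧`. -/
def completionEquiv :
    AdicCompletion (varIdeal K) (TensorPow K) ≃ₐ[K] MvPowerSeries (Fin 2) K :=
  (AlgEquiv.ofBijective (mvToCompletion K)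
    ⟨mvToCompletion_injective, mvToCompletion_surjective⟩).symm

lemma completionEquiv_algebraMap (a : TensorPow K) :
    completionEquiv K (algebraMap _ _ a) = toMv K a := by
  rw [← mvToCompletion_toMv]
  exact AlgEquiv.symm_apply_apply _ _

instance : IsNoetherianRing (AdicCompletion (varIdeal K) (TensorPow K)) :=
  isNoetherianRing_of_ringEquiv _ (completionEquiv K).symm.toRingEquiv

end Completion

/-! ### Differentials of `K⟦t⟧` are not finitely generated -/

section Differentials

open Polynomial PowerSeries

lemma coe_natCast_powerSeries {R : Type*} [CommSemiring R] (k : ℕ) :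
    ((k : R[X]) : R⟦X⟧) = (k : R⟦X⟧) :=
  map_natCast (Polynomial.coeToPowerSeries.ringHom (R := R)) _

section LinearIndependence

variable {K : Type*} [Field K]

/-- For c ≠ 0, the degree of c' is below that of c, while the degree of r c is not, so the two
cannot cancel. -/
lemma derivative_add_mul_injective {r : K[X]} (hr : r ≠ 0) {c : K[X]}
    (h : derivative c + r * c = 0) : c = 0 := by
  by_contra hc
  have h1 : (derivative c).degree < c.degree := degree_derivative_lt hc
  have h2 : c.degree ≤ (r * c).degree := by
    rw [mul_comm]
    exact degree_le_mul_left _ hr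
  rw [eq_neg_of_add_eq_zero_left h, degree_neg] at h1
  exact absurd h1 (not_lt.mpr h2)

lemma iterate_derivative_add_mul_injective {r : K[X]} (hr : r ≠ 0) (N : ℕ) {c : K[X]}
    (h : (fun c => derivative c + r * c)^[N] c = 0) : c = 0 := by
  induction N with
  | zero => exact h
  | succ N ih =>
    rw [Function.iterate_succ_apply'] at h
    exact ih (derivative_add_mul_injective hr h)

/-- Nonzero power series with distinct polynomial logarithmic derivatives are linearly independent
over the polynomials. -/
lemma eq_zero_of_sum_mul_eq_zero {ι : Type*} [DecidableEq ι] (q : ι → K[X])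
    (hq : Function.Injective q) (E : ι → K⟦X⟧) (hE : ∀ i, d⁄dX K (E i) = (q i : K⟦X⟧) * E i)
    (hE0 : ∀ i, E i ≠ 0) (s : Finset ι) (c : ι → K[X])
    (h : ∑ i ∈ s, (c i : K⟦X⟧) * E i = 0) : ∀ i ∈ s, c i = 0 := by
  induction s using Finset.induction_on generalizing c with
  | empty => simp
  | insert a s ha ih =>
    rw [Finset.sum_insert ha] at h
    -- The operator x ↦ x' − q_a x sends c E_i to (c' + (q_i − q_a) c) E_i. On the a-th term it only
    -- differentiates the coefficient; on the other coefficients it is injective. Iterating it kills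
    -- the a-th term.
    have key (N : ℕ) : ((derivative^[N] (c a) : K[X]) : K⟦X⟧) * E a +
        ∑ i ∈ s, (((fun c => derivative c + (q i - q a) * c)^[N] (c i) : K[X]) : K⟦X⟧) * E i
          = 0 := by
      induction N with
      | zero => exact h
      | succ N ihN =>
        have h1 := congrArg (fun x => d⁄dX K x - (q a : K⟦X⟧) * x) ihN
        simp only [map_add, map_sum, Derivation.leibniz, hE, derivative_coe, smul_eq_mul,
          map_zero, mul_zero, sub_zero] at h1
        rw [← h1]
        simp only [Function.iterate_succ_apply', mul_add, Finset.mul_sum, Polynomial.coe_add,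
          Polynomial.coe_mul, Polynomial.coe_sub]
        rw [add_sub_add_comm, ← Finset.sum_sub_distrib]
        congr 1
        · ring
        · exact Finset.sum_congr rfl fun i _ => by ring
    have hs : ∀ i ∈ s, c i = 0 := by
      have h2 := key ((c a).natDegree + 1)
      rw [iterate_derivative_eq_zero (Nat.lt_succ_self _), Polynomial.coe_zero, zero_mul,
        zero_add] at h2
      intro i hi
      have hia : i ≠ a := fun h => ha (h ▸ hi)
      exact iterate_derivative_add_mul_injective (sub_ne_zero.mpr (hq.ne hia)) _ (ih _ h2 i hi)
    rw [Finset.sum_eq_zero (fun i hi => by rw [hs i hi, Polynomial.coe_zero, zero_mul]),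
      add_zero, mul_eq_zero, Polynomial.coe_eq_zero_iff] at h
    intro i hi
    rcases Finset.mem_insert.mp hi with rfl | hi
    · exact h.resolve_right (hE0 _)
    · exact hs i hi

end LinearIndependence

variable (K : Type u) [Field K] [CharZero K]

/-- The power series `exp (t ^ (n + 1))`. -/
def expPow (n : ℕ) : K⟦X⟧ := (PowerSeries.exp K).subst (PowerSeries.X ^ (n + 1) : K⟦X⟧)

lemma derivative_expPow (n : ℕ) :
    d⁄dX K (expPow K n) = ((Polynomial.C ((n : K) + 1) * Polynomial.X ^ n : K[X]) : K⟦X⟧) *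
      expPow K n := by
  rw [expPow, derivative_subst (HasSubst.X_pow n.succ_ne_zero), derivative_exp, mul_comm,
    PowerSeries.derivative_pow]
  have h : ((Polynomial.C ((n : K) + 1) * Polynomial.X ^ n : K[X]) : K⟦X⟧) =
      (((n + 1 : ℕ) : K⟦X⟧)) * PowerSeries.X ^ n := by
    simp [coe_natCast_powerSeries]
  rw [h, PowerSeries.derivative_X, mul_one]
  rfl

lemma expPow_ne_zero (n : ℕ) : expPow K n ≠ 0 := by
  have h := (PowerSeries.isUnit_exp K).map
    (substAlgHom (R := K) (HasSubst.X_pow (R := K) n.succ_ne_zero))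
  rw [coe_substAlgHom] at h
  exact h.ne_zero

/-- The product `∏ exp (t ^ (n + 1)) ^ m n`. -/
def expMonomial (m : ℕ →₀ ℕ) : K⟦X⟧ := m.prod fun n k => expPow K n ^ k

/-- The logarithmic derivative of `expMonomial K m`. -/
def expMonomialLog (m : ℕ →₀ ℕ) : K[X] :=
  m.sum fun n k => k • (Polynomial.C ((n : K) + 1) * Polynomial.X ^ n)

lemma expMonomial_ne_zero (m : ℕ →₀ ℕ) : expMonomial K m ≠ 0 :=
  Finset.prod_ne_zero_iff.mpr fun n _ => pow_ne_zero _ (expPow_ne_zero K n)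

/-- The coefficient of tⁿ is (n + 1) m_n, from which characteristic zero recovers m_n. -/
lemma expMonomialLog_injective : Function.Injective (expMonomialLog K) := by
  intro m m' h
  have hc (m : ℕ →₀ ℕ) (n : ℕ) : (expMonomialLog K m).coeff n = m n * ((n : K) + 1) := by
    rw [expMonomialLog, Finsupp.sum, finsetSum_coeff]
    simp only [Polynomial.coeff_smul, Polynomial.coeff_C_mul, Polynomial.coeff_X_pow]
    rw [Finset.sum_eq_single n]
    · simp [mul_add]
    · intro b _ hb
      simp [hb.symm]
    · intro hn
      simp [Finsupp.notMem_support_iff.mp hn]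
  ext n
  have h1 := congrArg (fun p => Polynomial.coeff p n) h
  simp only [hc] at h1
  exact_mod_cast mul_right_cancel₀ (Nat.cast_add_one_ne_zero n) h1

lemma derivative_expMonomial (m : ℕ →₀ ℕ) :
    d⁄dX K (expMonomial K m) = (expMonomialLog K m : K⟦X⟧) * expMonomial K m := by
  induction m using Finsupp.induction_linear with
  | zero => simp [expMonomial, expMonomialLog]
  | add m m' h h' =>
    have h1 : expMonomial K (m + m') = expMonomial K m * expMonomial K m' :=
      Finsupp.prod_add_index' (fun _ => pow_zero _) (fun _ _ _ => pow_add _ _ _)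
    have h2 : expMonomialLog K (m + m') = expMonomialLog K m + expMonomialLog K m' :=
      Finsupp.sum_add_index' (fun _ => zero_smul _ _) (fun _ _ _ => add_smul _ _ _)
    rw [h1, h2, Derivation.leibniz, h, h', Polynomial.coe_add, smul_eq_mul, smul_eq_mul]
    ring
  | single n k =>
    have h1 : expMonomial K (Finsupp.single n k) = expPow K n ^ k :=
      Finsupp.prod_single_index (pow_zero _)
    have h2 : expMonomialLog K (Finsupp.single n k) =
        k • (Polynomial.C ((n : K) + 1) * Polynomial.X ^ n) :=
      Finsupp.sum_single_index (zero_smul _ _)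
    rw [h1, h2, Derivation.leibniz_pow, derivative_expPow, nsmul_eq_mul, Polynomial.coe_mul,
      smul_eq_mul, nsmul_eq_mul]
    rcases k with _ | k
    · simp
    · rw [Nat.add_sub_cancel, pow_succ]
      rw [Polynomial.coe_mul, Polynomial.coe_mul, coe_natCast_powerSeries]
      ring

/-- A polynomial relation among the exp(tⁿ⁺¹) is a linear relation, with constant coefficients,
among their monomials, whose logarithmic derivatives are distinct polynomials. -/
lemma algebraicIndependent_expPow : AlgebraicIndependent K (expPow K) := by
  classical
  rw [algebraicIndependent_iff]
  intro p hp
  rw [MvPolynomial.aeval_def, MvPolynomial.eval₂_eq] at hp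
  have h := eq_zero_of_sum_mul_eq_zero (expMonomialLog K) (expMonomialLog_injective K)
    (expMonomial K) (derivative_expMonomial K) (expMonomial_ne_zero K) p.support
    (fun m => Polynomial.C (p.coeff m)) (by
      rw [← hp]
      refine Finset.sum_congr rfl fun m _ => ?_
      rw [Polynomial.coe_C]
      rfl)
  ext m
  rw [MvPolynomial.coeff_zero]
  by_contra hm
  exact hm (Polynomial.C_eq_zero.mp (h m (MvPolynomial.mem_support_iff.mpr hm)))

open scoped IntermediateField.algebraAdjoinAdjoin in
/-- In characteristic zero, the differentials of a transcendence basis are linearly independent. -/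
lemma linearIndependent_D_of_isTranscendenceBasis {k L ι : Type*} [Field k] [CharZero k] [Field L]
    [Algebra k L] {x : ι → L} (hx : IsTranscendenceBasis k x) :
    LinearIndependent L fun i => KaehlerDifferential.D k L (x i) := by
  let S := Algebra.adjoin k (Set.range x)
  let F := IntermediateField.adjoin k (Set.range x)
  let : Algebra (MvPolynomial ι k) S := hx.1.aevalEquiv.toRingHom.toAlgebra
  let : Algebra (MvPolynomial ι k) L := (MvPolynomial.aeval x).toAlgebra
  have : IsScalarTower (MvPolynomial ι k) S L :=
    .of_algebraMap_eq fun p => (hx.1.algebraMap_aevalEquiv p).symm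
  have : IsScalarTower k (MvPolynomial ι k) L :=
    .of_algebraMap_eq fun c => ((MvPolynomial.aeval x).commutes c).symm
  -- L is formally étale over the polynomial ring on the basis: first an isomorphism onto k[x], then
  -- localization to k(x), then an algebraic extension, separable in characteristic zero. Hence the
  -- dX_i, a basis for polynomials, become a basis of Ω_{L/k}.
  have : Algebra.FormallyEtale (MvPolynomial ι k) S :=
    .of_equiv (AlgEquiv.ofRingEquiv (f := hx.1.aevalEquiv.toRingEquiv) fun _ => rfl)
  have : Algebra.FormallyEtale S F := .of_isLocalization (nonZeroDivisors _)
  have : Algebra.IsAlgebraic F L := hx.isAlgebraic_field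
  have : Algebra.FormallyEtale F L := .of_isSeparable _ L
  have : Algebra.FormallyEtale S L := .comp _ F _
  have : Algebra.FormallyEtale (MvPolynomial ι k) L := .comp _ S _
  let b := ((KaehlerDifferential.mvPolynomialBasis k ι).baseChange L).map
    (KaehlerDifferential.tensorKaehlerEquivOfFormallyEtale k (MvPolynomial ι k) L)
  have hb : (fun i => KaehlerDifferential.D k L (x i)) = b := by
    ext i
    rw [Module.Basis.map_apply, Module.Basis.baseChange_apply,
      KaehlerDifferential.mvPolynomialBasis_apply,
      KaehlerDifferential.tensorKaehlerEquivOfFormallyEtale_apply,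
      KaehlerDifferential.mapBaseChange_tmul, one_smul, KaehlerDifferential.map_D]
    exact congrArg _ (MvPolynomial.aeval_X x i).symm
  rw [hb]
  exact b.linearIndependent

/-- In characteristic zero, the differentials of algebraically independent elements of a field
extension are linearly independent. -/
lemma linearIndependent_D_of_algebraicIndependent {k L ι : Type*} [Field k] [CharZero k] [Field L]
    [Algebra k L] {x : ι → L} (hx : AlgebraicIndependent k x) :
    LinearIndependent L fun i => KaehlerDifferential.D k L (x i) := by
  obtain ⟨t, ht, hb⟩ := exists_isTranscendenceBasis_superset hx.coe_range
  exact (linearIndependent_D_of_isTranscendenceBasis hb).comp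
    (fun i => (⟨x i, ht ⟨i, rfl⟩⟩ : t)) fun i j hij => hx.injective (congrArg Subtype.val hij)

/-- `K⟦t⟧` has infinitely many differentials that are linearly independent. -/
lemma linearIndependent_D_expPow :
    LinearIndependent K⟦X⟧ fun n => KaehlerDifferential.D K K⟦X⟧ (expPow K n) := by
  let L := FractionRing K⟦X⟧
  have h : AlgebraicIndependent K fun n => algebraMap K⟦X⟧ L (expPow K n) :=
    (algebraicIndependent_expPow K).map' (f := IsScalarTower.toAlgHom K K⟦X⟧ L)
      (IsFractionRing.injective K⟦X⟧ L)
  have h2 := (linearIndependent_D_of_algebraicIndependent h).restrict_scalars' K⟦X⟧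
  -- Independence may be tested after mapping to the differentials of the fraction field.
  refine LinearIndependent.of_comp (KaehlerDifferential.map K K K⟦X⟧ L) ?_
  convert! h2 using 2 with n
  exact KaehlerDifferential.map_D _ _ _ _ _

/-- The module of differentials of `K⟦t⟧` is not finitely generated. -/
lemma not_finite_kaehlerDifferential :
    ¬ Module.Finite K⟦X⟧ (KaehlerDifferential K K⟦X⟧) := by
  intro h
  have := (linearIndependent_D_expPow K).finite_of_isNoetherian
  exact not_finite ℕ

end Differentials

/-! ### `I / I ^ 2` and the failure of noetherianity -/

section Cotangent

variable (R S : Type*) [CommRing R] [CommRing S] [Algebra R S]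

/-- The difference between x and the product of its factors, placed back in S ⊗ S, lies in the
kernel of multiplication, which annihilates its own cotangent module. -/
lemma kaehlerDifferential_tensor_smul (x : S ⊗[R] S) (y : KaehlerDifferential R S) :
    x • y = Algebra.TensorProduct.lmul' R (S := S) x • y := by
  obtain ⟨i, rfl⟩ := KaehlerDifferential.fromIdeal_surjective R S y
  rw [← algebraMap_smul (S ⊗[R] S) (Algebra.TensorProduct.lmul' R (S := S) x), ← sub_eq_zero,
    ← sub_smul]
  refine Ideal.Cotangent.smul_eq_zero_of_mem (I := KaehlerDifferential.ideal R S) ?_ _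
  rw [KaehlerDifferential.ideal, RingHom.mem_ker]
  simp

lemma finite_kaehlerDifferential_of_isNoetherianRing [IsNoetherianRing (S ⊗[R] S)] :
    Module.Finite S (KaehlerDifferential R S) := by
  have h : Module.Finite (S ⊗[R] S) (KaehlerDifferential R S) :=
    Module.Finite.of_surjective _ (KaehlerDifferential.fromIdeal_surjective R S)
  let σ : S ⊗[R] S →+* S := (Algebra.TensorProduct.lmul' R (S := S)).toRingHom
  have : RingHomSurjective σ := ⟨fun s => ⟨s ⊗ₜ 1, by simp [σ]⟩⟩
  -- The identity is semilinear along S ⊗ S → S, so generators over S ⊗ S also generate over S.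
  let f : KaehlerDifferential R S →ₛₗ[σ] KaehlerDifferential R S :=
    { AddMonoidHom.id _ with map_smul' := kaehlerDifferential_tensor_smul R S }
  exact Module.Finite.of_surjective f Function.surjective_id

end Cotangent

variable (K : Type u) [Field K]

/-- `I / I ^ 2` is the module of Kähler differentials of `K⟦t⟧`. -/
def cotangentEquiv : (diagIdeal K).Cotangent ≃+ KaehlerDifferential K (PowerSeries K) :=
  -- Kähler differentials are by construction the cotangent module of the kernel of multiplication.
  AddEquiv.refl (KaehlerDifferential K (PowerSeries K))

lemma cotangentEquiv_smul (x : TensorPow K) (y : (diagIdeal K).Cotangent) :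
    cotangentEquiv K (x • y) =
      Algebra.TensorProduct.lmul' K (S := PowerSeries K) x • cotangentEquiv K y :=
  kaehlerDifferential_tensor_smul K (PowerSeries K) x (cotangentEquiv K y)

lemma not_isNoetherianRing_tensorPow [CharZero K] : ¬ IsNoetherianRing (TensorPow K) := fun _ =>
  not_finite_kaehlerDifferential K
    (finite_kaehlerDifferential_of_isNoetherianRing K (PowerSeries K))

/-! ### The completion is not flat -/

section NotFlat

open PowerSeries (X)

/-- The power series `(f(X₁) - f(X₀)) / (X₁ - X₀)`. -/
def dividedDifference {K : Type u} [Field K] (f : PowerSeries K) : MvPowerSeries (Fin 2) K :=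
  fun m => PowerSeries.coeff (m 0 + m 1 + 1) f

lemma coeff_X_mul_eq_ite {R : Type*} [CommSemiring R] (s : Fin 2) (p : MvPowerSeries (Fin 2) R)
    (m : Fin 2 →₀ ℕ) :
    MvPowerSeries.coeff m (MvPowerSeries.X s * p) =
      if m s = 0 then 0 else MvPowerSeries.coeff (m - Finsupp.single s 1) p := by
  classical
  rw [MvPowerSeries.X, MvPowerSeries.coeff_monomial_mul, one_mul]
  simp only [Finsupp.single_le_iff, Nat.one_le_iff_ne_zero]
  split_ifs <;> simp_all

variable {K : Type u} [Field K]

lemma toMv_X_left : toMv K (X ⊗ₜ 1) = MvPowerSeries.X 0 := by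
  classical
  ext m
  rw [toMv_tmul, coeff_outer, PowerSeries.coeff_X, PowerSeries.coeff_one, MvPowerSeries.coeff_X,
    ite_zero_mul_ite_zero, one_mul]
  refine if_congr ⟨fun h => ?_, fun h => by simp [h]⟩ rfl rfl
  rw [← expPair_eta m, h.1, h.2]
  ext i; fin_cases i <;> simp [expPair]

lemma toMv_X_right : toMv K (1 ⊗ₜ X) = MvPowerSeries.X 1 := by
  classical
  ext m
  rw [toMv_tmul, coeff_outer, PowerSeries.coeff_X, PowerSeries.coeff_one, MvPowerSeries.coeff_X,
    ite_zero_mul_ite_zero, one_mul]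
  refine if_congr ⟨fun h => ?_, fun h => by simp [h]⟩ rfl rfl
  rw [← expPair_eta m, h.1, h.2]
  ext i; fin_cases i <;> simp [expPair]

/-- With q the divided difference, X₁ q and X₀ q both have coefficient f_{i+j} at (i, j), except
that the first vanishes for j = 0 and the second for i = 0. They cancel off the axes. -/
lemma toMv_sub_eq_mul_dividedDifference (f : PowerSeries K) :
    toMv K (1 ⊗ₜ f - f ⊗ₜ 1) = toMv K (1 ⊗ₜ X - X ⊗ₜ 1) * dividedDifference f := by
  ext m
  rw [map_sub, map_sub, map_sub, toMv_X_left, toMv_X_right, sub_mul, map_sub, coeff_X_mul_eq_ite,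
    coeff_X_mul_eq_ite, toMv_tmul, toMv_tmul, coeff_outer, coeff_outer]
  change _ = (if _ then 0 else PowerSeries.coeff _ f) - (if _ then 0 else PowerSeries.coeff _ f)
  simp only [PowerSeries.coeff_one, Finsupp.coe_tsub, Pi.sub_apply, Finsupp.single_apply]
  rcases h0 : m 0 with _ | a <;> rcases h1 : m 1 with _ | b <;> simp
  rw [add_right_comm a 1 b, add_assoc a b 1, sub_self]

/-- Both sides evaluate at t₁ = t₂ = 0. This detects the elements of A that become units on the
diagonal. -/
lemma constantCoeff_lmul' (b : TensorPow K) :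
    PowerSeries.constantCoeff (Algebra.TensorProduct.lmul' K (S := PowerSeries K) b) =
      MvPowerSeries.constantCoeff (toMv K b) := by
  induction b using TensorProduct.induction_on with
  | zero => rw [map_zero, map_zero, map_zero, map_zero]
  | add a b ha hb => rw [map_add, map_add, map_add, map_add, ha, hb]
  | tmul f g =>
    rw [Algebra.TensorProduct.lmul'_apply_tmul, map_mul, toMv_tmul,
      ← MvPowerSeries.coeff_zero_eq_constantCoeff_apply, coeff_outer]
    simp

/-- The equational criterion for flatness, applied to the relation a · 1 + b · y = 0. Keeping the
coordinates of 1 forces some c j to be outside any ideal that generates a proper ideal of M. -/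
lemma exists_of_flat_of_add_mul_eq_zero {R M : Type*} [CommRing R] [CommRing M] [Algebra R M]
    [Module.Flat R M] {a b : R} {y : M} (h : algebraMap R M a + algebraMap R M b * y = 0) :
    ∃ (k : ℕ) (c d : Fin k → R) (z : Fin k → M),
      1 = ∑ j, algebraMap R M (c j) * z j ∧ ∀ j, c j * a + d j * b = 0 := by
  obtain ⟨k, c, z, hx, hc⟩ := Module.Flat.isTrivialRelation_of_sum_smul_eq_zero (R := R) (M := M)
    (f := ![a, b]) (x := ![1, y]) (by simpa [Algebra.smul_def] using h)
  refine ⟨k, c 0, c 1, z, ?_, fun j => ?_⟩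
  · simpa [Algebra.smul_def] using hx 0
  · simpa [mul_comm] using hc j

/-- The differential of f is the class of 1 ⊗ f − f ⊗ 1 in I / I ^ 2, so the hypothesis only has to
be read there. -/
lemma lmul'_smul_D_add_eq_zero {R S : Type*} [CommRing R] [CommRing S] [Algebra R S] {f g : S}
    {a b : S ⊗[R] S} (h : a * (1 ⊗ₜ f - f ⊗ₜ 1) + b * (1 ⊗ₜ g - g ⊗ₜ 1) = 0) :
    Algebra.TensorProduct.lmul' R (S := S) a • KaehlerDifferential.D R S f +
      Algebra.TensorProduct.lmul' R (S := S) b • KaehlerDifferential.D R S g = 0 := by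
  have hD (g : S) : KaehlerDifferential.D R S g = KaehlerDifferential.fromIdeal R S
      ⟨1 ⊗ₜ g - g ⊗ₜ 1, KaehlerDifferential.one_smul_sub_smul_one_mem_ideal R g⟩ := rfl
  rw [← kaehlerDifferential_tensor_smul, ← kaehlerDifferential_tensor_smul, hD, hD, ← map_smul,
    ← map_smul, ← map_add]
  refine (congrArg _ ?_).trans (map_zero (KaehlerDifferential.fromIdeal R S))
  exact Subtype.ext h

/-- If the completion is flat, then `K⟦t⟧ dt` is the module of differentials of `K⟦t⟧`. -/
lemma D_mem_span_of_flat
    [Module.Flat (TensorPow K) (AdicCompletion (varIdeal K) (TensorPow K))] (f : PowerSeries K) :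
    KaehlerDifferential.D K (PowerSeries K) f ∈
      Submodule.span (PowerSeries K) {KaehlerDifferential.D K (PowerSeries K) X} := by
  have hrel : algebraMap (TensorPow K) (AdicCompletion (varIdeal K) (TensorPow K))
        (1 ⊗ₜ f - f ⊗ₜ 1) +
      algebraMap (TensorPow K) (AdicCompletion (varIdeal K) (TensorPow K)) (1 ⊗ₜ X - X ⊗ₜ 1) *
        (-(completionEquiv K).symm (dividedDifference f)) = 0 := by
    refine (completionEquiv K).injective ?_
    rw [map_add, map_mul, completionEquiv_algebraMap, completionEquiv_algebraMap,
      toMv_sub_eq_mul_dividedDifference, map_neg, AlgEquiv.apply_symm_apply, mul_neg,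
      add_neg_cancel, map_zero]
  obtain ⟨k, a, b, y, hx, ha⟩ := exists_of_flat_of_add_mul_eq_zero hrel
  have h1 := congrArg (completionEquiv K) hx
  rw [map_one, map_sum] at h1
  -- Otherwise every summand in the expression of 1 would have zero constant term.
  obtain ⟨j, hj⟩ : ∃ j, MvPowerSeries.constantCoeff (toMv K (a j)) ≠ 0 := by
    by_contra! h
    have h2 := congrArg MvPowerSeries.constantCoeff h1
    rw [map_one, map_sum] at h2
    refine one_ne_zero (h2.trans (Finset.sum_eq_zero fun j _ => ?_))
    rw [map_mul (completionEquiv K), completionEquiv_algebraMap, map_mul, h, zero_mul]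
  have hunit : IsUnit (Algebra.TensorProduct.lmul' K (S := PowerSeries K) (a j)) := by
    rw [PowerSeries.isUnit_iff_constantCoeff, constantCoeff_lmul']
    exact hj.isUnit
  rw [← Submodule.smul_mem_iff_of_isUnit _ hunit,
    eq_neg_of_add_eq_zero_left (lmul'_smul_D_add_eq_zero (ha j))]
  exact Submodule.neg_mem _ (Submodule.smul_mem _ _ (Submodule.mem_span_singleton_self _))

lemma not_flat_completion [CharZero K] :
    ¬ Module.Flat (TensorPow K) (AdicCompletion (varIdeal K) (TensorPow K)) := by
  intro _
  refine not_finite_kaehlerDifferential K ⟨⟨{KaehlerDifferential.D K (PowerSeries K) X}, ?_⟩⟩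
  rw [Finset.coe_singleton, eq_top_iff, ← KaehlerDifferential.span_range_derivation,
    Submodule.span_le]
  rintro _ ⟨f, rfl⟩
  exact D_mem_span_of_flat f

end NotFlat

/-! ### Koszul homology of a regular pair -/

section KoszulPair

variable {A : Type u} [CommRing A]

/-- The element `e₀ ∧ e₁` of the exterior algebra of `A ^ 2`. -/
def wedgePair : ExteriorAlgebra A (Fin 2 → A) :=
  ExteriorAlgebra.ι A ![1, 0] * ExteriorAlgebra.ι A ![0, 1]

lemma ι_mul_ι_eq_smul_wedgePair (v w : Fin 2 → A) :
    ExteriorAlgebra.ι A v * ExteriorAlgebra.ι A w =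
      (v 0 * w 1 - v 1 * w 0) • (wedgePair : ExteriorAlgebra A (Fin 2 → A)) := by
  have h (v : Fin 2 → A) : ExteriorAlgebra.ι A v =
      v 0 • ExteriorAlgebra.ι A ![1, 0] + v 1 • ExteriorAlgebra.ι A ![0, 1] := by
    rw [← map_smul, ← map_smul, ← map_add]
    congr 1
    ext i; fin_cases i <;> simp
  have h2 : ExteriorAlgebra.ι A (![0, 1] : Fin 2 → A) * ExteriorAlgebra.ι A ![1, 0] =
      -wedgePair :=
    eq_neg_of_add_eq_zero_left (ExteriorAlgebra.ι_add_mul_swap _ _)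
  have h3 : ExteriorAlgebra.ι A (![1, 0] : Fin 2 → A) * ExteriorAlgebra.ι A ![0, 1] =
      wedgePair := rfl
  rw [h v, h w]
  simp only [add_mul, mul_add, smul_mul_assoc, mul_smul_comm, ExteriorAlgebra.ι_sq_zero, smul_zero,
    h2]
  simp only [h3, smul_neg, sub_smul, smul_smul, zero_add, add_zero]
  rw [mul_comm (w 0) (v 1), mul_comm (w 1) (v 0)]
  abel

lemma exists_eq_smul_wedgePair {x : ExteriorAlgebra A (Fin 2 → A)}
    (hx : x ∈ ⋀[A]^2 (Fin 2 → A)) : ∃ c : A, x = c • wedgePair := by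
  rw [ExteriorAlgebra.exteriorPower, pow_two] at hx
  refine Submodule.mul_induction_on hx ?_ ?_
  · rintro _ ⟨v, rfl⟩ _ ⟨w, rfl⟩
    exact ⟨_, ι_mul_ι_eq_smul_wedgePair v w⟩
  · rintro _ _ ⟨c, rfl⟩ ⟨d, rfl⟩
    exact ⟨c + d, (add_smul _ _ _).symm⟩

lemma wedgePair_mem : wedgePair ∈ ⋀[A]^2 (Fin 2 → A) := by
  rw [ExteriorAlgebra.exteriorPower, pow_two]
  exact Submodule.mul_mem_mul ⟨_, rfl⟩ ⟨_, rfl⟩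

lemma contractLeft_wedgePair (a : Fin 2 → A) :
    CliffordAlgebra.contractLeft (Q := 0) (koszulFunctional a) wedgePair =
      ExteriorAlgebra.ι A ![-a 1, a 0] := by
  have h : CliffordAlgebra.contractLeft (Q := 0) (koszulFunctional a)
      (CliffordAlgebra.ι 0 ![1, 0] * CliffordAlgebra.ι 0 ![0, 1]) =
        CliffordAlgebra.ι 0 ![-a 1, a 0] := by
    rw [CliffordAlgebra.contractLeft_ι_mul, CliffordAlgebra.contractLeft_ι, ← map_smul,
      ← Algebra.commutes, ← Algebra.smul_def, ← map_smul, ← map_sub]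
    congr 1
    ext i; fin_cases i <;> simp [koszulFunctional, Fintype.linearCombination_apply]
  exact h

lemma subsingleton_exteriorPower {n i : ℕ} (h : n < i) : Subsingleton (⋀[A]^i (Fin n → A)) := by
  have : IsEmpty (Set.powersetCard (Fin n) i) := by
    refine ⟨fun s => ?_⟩
    have h1 := Finset.card_le_univ s.1
    rw [show s.1.card = i from s.2, Fintype.card_fin] at h1
    omega
  exact ((Pi.basisFun A (Fin n)).exteriorPower i).repr.toEquiv.subsingleton

/-- The Koszul complex of a regular sequence of length two is exact in positive degrees. -/
lemma koszulD_exact {a : Fin 2 → A} (h0 : ∀ x, a 0 * x = 0 → x = 0)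
    (h1 : ∀ x y, a 1 * x = a 0 * y → ∃ z, x = a 0 * z) (i : ℕ) (x : ⋀[A]^(i + 1) (Fin 2 → A))
    (hx : koszulD a i x = 0) : ∃ y, koszulD a (i + 1) y = x := by
  obtain ⟨x, hxm⟩ := x
  have hx' : CliffordAlgebra.contractLeft (Q := 0) (koszulFunctional a) x = 0 :=
    congrArg Subtype.val hx
  match i with
  | 0 =>
    rw [ExteriorAlgebra.exteriorPower, zero_add, pow_one] at hxm
    obtain ⟨v, rfl⟩ := hxm
    have h2 : koszulFunctional a v = 0 := by
      refine ExteriorAlgebra.algebraMap_leftInverse (R := A) (Fin 2 → A) |>.injective ?_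
      rw [map_zero, ← hx']
      exact (CliffordAlgebra.contractLeft_ι _ _ _).symm
    have h3 : v 0 * a 0 + v 1 * a 1 = 0 := by
      simpa [koszulFunctional, Fintype.linearCombination_apply] using h2
    -- The cycle condition is a₁ v₁ = a₀ (−v₀). Regularity gives v₁ = a₀ w and then v₀ = −a₁ w, so v
    -- is the boundary of w e₀ ∧ e₁.
    obtain ⟨w, hw⟩ := h1 (v 1) (-v 0) (by linear_combination h3)
    have hv0 : v 0 + a 1 * w = 0 := h0 _ (by rw [hw] at h3; linear_combination h3)
    refine ⟨⟨w • wedgePair, Submodule.smul_mem _ _ wedgePair_mem⟩, Subtype.ext ?_⟩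
    change CliffordAlgebra.contractLeft (Q := 0) (koszulFunctional a) (w • wedgePair) =
      ExteriorAlgebra.ι A v
    rw [map_smul, contractLeft_wedgePair, ← map_smul]
    congr 1
    ext i; fin_cases i
    · simp only [Fin.zero_eta, Pi.smul_apply, Matrix.cons_val_zero, smul_eq_mul]
      linear_combination -hv0
    · simp [hw, mul_comm]
  | 1 =>
    obtain ⟨c, rfl⟩ := exists_eq_smul_wedgePair hxm
    rw [map_smul, contractLeft_wedgePair, ← map_smul] at hx'
    have h2 := (ExteriorAlgebra.ι_eq_zero_iff _).mp hx'
    have h3 : c = 0 := h0 c (by simpa [mul_comm] using congrFun h2 1)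
    refine ⟨0, Subtype.ext ?_⟩
    simp [h3]
  | i + 2 =>
    have := subsingleton_exteriorPower (A := A) (n := 2) (i := i + 2 + 1) (by omega)
    exact ⟨0, Subsingleton.elim _ _⟩

lemma isZero_homology_koszul {a : Fin 2 → A} (h0 : ∀ x, a 0 * x = 0 → x = 0)
    (h1 : ∀ x y, a 1 * x = a 0 * y → ∃ z, x = a 0 * z) {i : ℕ} (hi : 0 < i) :
    Limits.IsZero ((koszul a).homology i) := by
  obtain ⟨i, rfl⟩ := Nat.exists_eq_succ_of_ne_zero hi.ne'
  rw [← HomologicalComplex.exactAt_iff_isZero_homology,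
    HomologicalComplex.exactAt_iff' _ (i + 2) (i + 1) i (by simp) (by simp),
    ShortComplex.moduleCat_exact_iff]
  intro x hx
  obtain ⟨y, hy⟩ := koszulD_exact h0 h1 i x (by
    have h : (koszul a).d (i + 1) i x = 0 := hx
    rw [koszul_d] at h
    exact h)
  refine ⟨y, ?_⟩
  change (koszul a).d (i + 2) (i + 1) y = x
  rw [koszul_d]
  exact hy

/-- Powers of a regular pair again form a regular pair, so the homology itself vanishes and l = k
works. -/
lemma isWeaklyProregularSeq_pair {a : Fin 2 → A} (h0 : ∀ x, a 0 * x = 0 → x = 0)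
    (h1 : ∀ x y, a 1 * x = a 0 * y → ∃ z, x = a 0 * z) : IsWeaklyProregularSeq a := by
  have h0' (k : ℕ) (x : A) (hx : a 0 ^ k * x = 0) : x = 0 := by
    induction k with
    | zero => simpa using hx
    | succ k ih => exact ih (h0 _ (by rw [← hx]; ring))
  have h1' (k : ℕ) (x y : A) (hxy : a 1 ^ k * x = a 0 * y) : ∃ z, x = a 0 * z := by
    induction k generalizing y with
    | zero => exact ⟨y, by simpa using hxy⟩
    | succ k ih =>
      obtain ⟨z, hz⟩ := h1 (a 1 ^ k * x) y (by rw [← hxy]; ring)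
      exact ih z hz
  -- Factors a₀ are split off x and cancelled one at a time.
  have h1'' (k l : ℕ) (x y : A) (hxy : a 1 ^ k * x = a 0 ^ l * y) : ∃ z, x = a 0 ^ l * z := by
    induction l generalizing x y with
    | zero => exact ⟨x, by simp⟩
    | succ l ih =>
      obtain ⟨z, rfl⟩ := h1' k x (a 0 ^ l * y) (by rw [hxy]; ring)
      obtain ⟨w, rfl⟩ := ih z y (sub_eq_zero.mp (h0 _ (by linear_combination hxy)))
      exact ⟨w, by ring⟩
  intro i hi k _
  exact ⟨k, le_rfl, (isZero_homology_koszul (h0' k) (h1'' k k) hi).eq_of_src _ _⟩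

end KoszulPair

/-! ### The sequence `(t₁, t₂)` is regular on `K⟦t₁⟧ ⊗ K⟦t₂⟧` -/

section RegularSequence

open PowerSeries (X)

variable (K : Type u) [Field K]

/-- The sequence `(t₁, t₂)`. -/
def varSeq : Fin 2 → TensorPow K := ![X ⊗ₜ 1, 1 ⊗ₜ X]

variable {K}

lemma X_tmul_one_mul_eq (x : TensorPow K) :
    (X ⊗ₜ 1 : TensorPow K) * x = (LinearMap.mulLeft K X).rTensor (PowerSeries K) x := by
  have h : LinearMap.mulLeft K (X ⊗ₜ 1 : TensorPow K) =
      (LinearMap.mulLeft K X).rTensor (PowerSeries K) := by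
    ext f g
    simp
  exact LinearMap.congr_fun h x

lemma one_tmul_X_mul_eq (x : TensorPow K) :
    (1 ⊗ₜ X : TensorPow K) * x = (LinearMap.mulLeft K X).lTensor (PowerSeries K) x := by
  have h : LinearMap.mulLeft K (1 ⊗ₜ X : TensorPow K) =
      (LinearMap.mulLeft K X).lTensor (PowerSeries K) := by
    ext f g
    simp
  exact LinearMap.congr_fun h x

lemma mulLeft_X_injective :
    Function.Injective (LinearMap.mulLeft K (X : PowerSeries K)) :=
  mul_right_injective₀ PowerSeries.X_ne_zero

variable (K)

lemma X_tmul_one_mul_injective (x : TensorPow K) (h : (X ⊗ₜ 1 : TensorPow K) * x = 0) :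
    x = 0 := by
  rw [X_tmul_one_mul_eq] at h
  exact (map_eq_zero_iff _
    (Module.Flat.rTensor_preserves_injective_linearMap _ mulLeft_X_injective)).mp h

/-- Tensoring K⟦t⟧ → K⟦t⟧ → K → 0 with K⟦t₂⟧ identifies A ⧸ (t₁) with K ⊗ K⟦t₂⟧, where t₂ acts
injectively because K is a field. -/
lemma exists_eq_X_tmul_one_mul (x y : TensorPow K)
    (h : (1 ⊗ₜ X : TensorPow K) * x = (X ⊗ₜ 1) * y) : ∃ z, x = (X ⊗ₜ 1) * z := by
  let g : PowerSeries K →ₗ[K] K := PowerSeries.coeff 0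
  have hexact : Function.Exact (LinearMap.mulLeft K (X : PowerSeries K)) g := by
    intro f
    change PowerSeries.coeff 0 f = 0 ↔ _
    rw [PowerSeries.coeff_zero_eq_constantCoeff_apply, ← PowerSeries.X_dvd_iff]
    exact ⟨fun ⟨p, hp⟩ => ⟨p, hp.symm⟩, fun ⟨p, hp⟩ => ⟨p, hp.symm⟩⟩
  have hg : Function.Surjective g := fun c => ⟨PowerSeries.C c, by simp [g]⟩
  have hA := rTensor_exact (PowerSeries K) hexact hg
  have hcomm : (LinearMap.mulLeft K X).lTensor K (g.rTensor (PowerSeries K) x) =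
      g.rTensor (PowerSeries K) ((LinearMap.mulLeft K X).lTensor (PowerSeries K) x) := by
    rw [← LinearMap.comp_apply, ← LinearMap.comp_apply, LinearMap.lTensor_comp_rTensor,
      LinearMap.rTensor_comp_lTensor]
  rw [← one_tmul_X_mul_eq, h, X_tmul_one_mul_eq, hA.apply_apply_eq_zero] at hcomm
  have hx := (map_eq_zero_iff _
    (Module.Flat.lTensor_preserves_injective_linearMap _ mulLeft_X_injective)).mp hcomm
  obtain ⟨z, hz⟩ := (hA x).mp hx
  exact ⟨z, by rw [X_tmul_one_mul_eq, hz]⟩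

lemma isWeaklyProregular_varIdeal : IsWeaklyProregular (varIdeal K) := by
  refine ⟨2, varSeq K, ?_, isWeaklyProregularSeq_pair (X_tmul_one_mul_injective K)
    (exists_eq_X_tmul_one_mul K)⟩
  rw [varIdeal, varSeq, Matrix.range_cons, Matrix.range_cons, Matrix.range_empty, Set.union_empty,
    Set.singleton_union]

end RegularSequence

/-! ### Vanishing of Tor by dévissage -/

section TensorExact

variable {A : Type*} [CommRing A] {P : ℕ → Type*} [∀ n, AddCommGroup (P n)] [∀ n, Module A (P n)]
  (d : ∀ n, P (n + 1) →ₗ[A] P n)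

/-- Tensoring with `N` preserves the exactness of the sequence `⋯ → P 2 → P 1 → P 0` at every
`P (n + 1)`. -/
def IsTensorExact (N : Type*) [AddCommGroup N] [Module A N] : Prop :=
  ∀ n, Function.Exact ((d (n + 1)).lTensor N) ((d n).lTensor N)

variable {d}

lemma lTensor_rTensor_comm {N N' P Q : Type*} [AddCommGroup N] [Module A N] [AddCommGroup N']
    [Module A N'] [AddCommGroup P] [Module A P] [AddCommGroup Q] [Module A Q]
    (f : N →ₗ[A] N') (g : P →ₗ[A] Q) (x : N ⊗[A] P) :
    g.lTensor N' (f.rTensor P x) = f.rTensor Q (g.lTensor N x) := by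
  rw [← LinearMap.comp_apply, ← LinearMap.comp_apply, LinearMap.lTensor_comp_rTensor,
    LinearMap.rTensor_comp_lTensor]

lemma lTensor_lTensor_eq_zero (N : Type*) [AddCommGroup N] [Module A N]
    (hd : ∀ n, Function.Exact (d (n + 1)) (d n)) (n : ℕ) (x : N ⊗[A] P (n + 2)) :
    (d n).lTensor N ((d (n + 1)).lTensor N x) = 0 := by
  rw [← LinearMap.lTensor_comp_apply, (hd n).linearMap_comp_eq_zero, LinearMap.lTensor_zero,
    LinearMap.zero_apply]

lemma isTensorExact_of_forall (N : Type*) [AddCommGroup N] [Module A N]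
    (hd : ∀ n, Function.Exact (d (n + 1)) (d n))
    (h : ∀ n (x : N ⊗[A] P (n + 1)), (d n).lTensor N x = 0 → ∃ y, (d (n + 1)).lTensor N y = x) :
    IsTensorExact d N := fun n x =>
  ⟨h n x, fun ⟨y, hy⟩ => hy ▸ lTensor_lTensor_eq_zero N hd n y⟩

variable {N' N N'' : Type*} [AddCommGroup N'] [Module A N'] [AddCommGroup N] [Module A N]
  [AddCommGroup N''] [Module A N''] {i : N' →ₗ[A] N} {p : N →ₗ[A] N''}

/-- For a flat resolution, tensor exactness is the vanishing of all Tor of positive degree; this is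
the middle of the long exact sequence, chased by hand. -/
lemma IsTensorExact.extension [∀ n, Module.Flat A (P n)]
    (hd : ∀ n, Function.Exact (d (n + 1)) (d n))
    (hi : Function.Injective i) (hip : Function.Exact i p) (hp : Function.Surjective p)
    (h' : IsTensorExact d N') (h'' : IsTensorExact d N'') : IsTensorExact d N := by
  refine isTensorExact_of_forall N hd fun n x hx => ?_
  obtain ⟨y'', hy''⟩ := (h'' n (p.rTensor _ x)).mp (by rw [lTensor_rTensor_comm, hx, map_zero])
  obtain ⟨y, rfl⟩ := LinearMap.rTensor_surjective _ hp y''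
  obtain ⟨x', hx'⟩ := (rTensor_exact (P (n + 1)) hip hp (x - (d (n + 1)).lTensor N y)).mp (by
    rw [map_sub, ← lTensor_rTensor_comm, hy'', sub_self])
  obtain ⟨y', rfl⟩ := (h' n x').mp (by
    refine Module.Flat.rTensor_preserves_injective_linearMap (M := P n) i hi ?_
    rw [← lTensor_rTensor_comm, hx', map_sub, hx, lTensor_lTensor_eq_zero N hd, sub_zero,
      map_zero])
  refine ⟨y + i.rTensor _ y', ?_⟩
  rw [map_add, lTensor_rTensor_comm, hx']
  abel

/-- By the long exact sequence, Tor of N'' sits between Tor of N and Tor of N' one degree lower. In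
degree one the latter is N' ⊗ M, which is why injectivity of N' ⊗ M → N ⊗ M is needed. -/
lemma IsTensorExact.quotient [∀ n, Module.Flat A (P n)]
    (hd : ∀ n, Function.Exact (d (n + 1)) (d n))
    {M : Type*} [AddCommGroup M] [Module A M] {ε : P 0 →ₗ[A] M} (hε : Function.Surjective ε)
    (hdε : Function.Exact (d 0) ε)
    (hi : Function.Injective i) (hip : Function.Exact i p) (hp : Function.Surjective p)
    (hiM : Function.Injective (i.rTensor M))
    (h' : IsTensorExact d N') (h : IsTensorExact d N) : IsTensorExact d N'' := by
  refine isTensorExact_of_forall N'' hd fun n x'' hx'' => ?_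
  obtain ⟨x, rfl⟩ := LinearMap.rTensor_surjective _ hp x''
  rw [lTensor_rTensor_comm] at hx''
  obtain ⟨x', hx'⟩ := (rTensor_exact (P n) hip hp _).mp hx''
  -- x' represents the image of the class of x under the connecting map; it has to be a boundary.
  obtain ⟨y', rfl⟩ : ∃ y', (d n).lTensor N' y' = x' := by
    match n with
    | 0 =>
      refine (lTensor_exact N' hdε hε x').mp (hiM ?_)
      rw [← lTensor_rTensor_comm, hx', ← LinearMap.lTensor_comp_apply,
        hdε.linearMap_comp_eq_zero, LinearMap.lTensor_zero, LinearMap.zero_apply, map_zero]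
    | n + 1 =>
      refine (h' n x').mp
        (Module.Flat.rTensor_preserves_injective_linearMap (M := P n) i hi ?_)
      rw [← lTensor_rTensor_comm, hx', lTensor_lTensor_eq_zero N hd, map_zero]
  obtain ⟨z, hz⟩ := (h n (x - i.rTensor _ y')).mp (by
    rw [map_sub, lTensor_rTensor_comm, hx', sub_self])
  refine ⟨p.rTensor _ z, ?_⟩
  rw [lTensor_rTensor_comm, hz, map_sub, sub_eq_self]
  exact (rTensor_exact (P (n + 1)) hip hp).apply_apply_eq_zero y'

lemma isTensorExact_of_flat (hd : ∀ n, Function.Exact (d (n + 1)) (d n))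
    (N : Type*) [AddCommGroup N] [Module A N] [Module.Flat A N] : IsTensorExact d N :=
  fun n => Module.Flat.lTensor_exact N (hd n)

lemma isTensorExact_of_subsingleton [Subsingleton N] : IsTensorExact d N := fun _ _ =>
  ⟨fun _ => ⟨0, Subsingleton.elim _ _⟩, fun _ => Subsingleton.elim _ _⟩

lemma cancelBaseChange_comm {k : Type*} [CommRing k] [Algebra A k] (N : Type*) [AddCommGroup N]
    [Module A N] [Module k N] [IsScalarTower A k N] {P Q : Type*} [AddCommGroup P] [Module A P]
    [AddCommGroup Q] [Module A Q] (f : P →ₗ[A] Q) :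
    f.lTensor N ∘ₗ
        ((AlgebraTensorModule.cancelBaseChange A k k N P).restrictScalars A).toLinearMap =
      ((AlgebraTensorModule.cancelBaseChange A k k N Q).restrictScalars A).toLinearMap ∘ₗ
        ((f.baseChange k).lTensor N).restrictScalars A := by
  refine LinearMap.ext fun x => ?_
  induction x using TensorProduct.induction_on with
  | zero => rw [map_zero, map_zero]
  | add x y hx hy => rw [map_add, map_add, hx, hy]
  | tmul x y =>
    induction y using TensorProduct.induction_on with
    | zero => rw [TensorProduct.tmul_zero, map_zero, map_zero]
    | add y z hy hz => rw [TensorProduct.tmul_add, map_add, map_add, hy, hz]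
    | tmul a p => simp

/-- Tensor exactness passes from a field `k` that is an `A`-algebra to all `k`-vector spaces. -/
lemma IsTensorExact.of_field {k : Type*} [Field k] [Algebra A k] [Module k N] [IsScalarTower A k N]
    (h : IsTensorExact d k) : IsTensorExact d N := fun n => by
  -- N ⊗_A P is N ⊗_k (k ⊗_A P), and tensoring over a field is exact.
  have h1 : Function.Exact ((d (n + 1)).baseChange k) ((d n).baseChange k) := h n
  refine Function.Exact.of_ladder_linearEquiv_of_exact
    (e₁ := AlgebraTensorModule.cancelBaseChange A k k N (P (n + 2)) |>.restrictScalars A)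
    (e₂ := AlgebraTensorModule.cancelBaseChange A k k N (P (n + 1)) |>.restrictScalars A)
    (e₃ := AlgebraTensorModule.cancelBaseChange A k k N (P n) |>.restrictScalars A)
    (f₁₂ := (((d (n + 1)).baseChange k).lTensor N).restrictScalars A)
    (f₂₃ := (((d n).baseChange k).lTensor N).restrictScalars A)
    (cancelBaseChange_comm N _) (cancelBaseChange_comm N _)
    (Module.Flat.lTensor_exact (R := k) N h1)

/-- Tensor exactness passes from the residue field of a maximal ideal to all modules killed by a
power of the ideal. -/
lemma IsTensorExact.of_pow_smul_eq_zero [∀ n, Module.Flat A (P n)]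
    (hd : ∀ n, Function.Exact (d (n + 1)) (d n)) {I : Ideal A} [hI : I.IsMaximal]
    (h : IsTensorExact d (A ⧸ I)) (k : ℕ) {N : Type*} [AddCommGroup N] [Module A N]
    (hN : ∀ r ∈ I ^ k, ∀ x : N, r • x = 0) : IsTensorExact d N := by
  induction k generalizing N with
  | zero =>
    have : Subsingleton N := subsingleton_of_forall_eq 0 fun x => by
      rw [← one_smul A x]
      exact hN 1 (by simp) x
    exact isTensorExact_of_subsingleton
  | succ k ih =>
    -- S is killed by I ^ k, and N ⧸ S is a vector space over A ⧸ I.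
    let S : Submodule A N := I • ⊤
    have h1 : IsTensorExact d S := by
      refine ih fun r hr x => Subtype.ext ?_
      obtain ⟨x, hx⟩ := x
      change r • x = 0
      refine Submodule.smul_induction_on hx (fun s hs y _ => ?_) fun y z hy hz => ?_
      · rw [smul_smul]
        exact hN _ (pow_succ I k ▸ Ideal.mul_mem_mul hr hs) y
      · rw [smul_add, hy, hz, add_zero]
    have h2 : IsTensorExact d (N ⧸ S) := by
      let : Field (A ⧸ I) := Ideal.Quotient.field I
      exact IsTensorExact.of_field (k := A ⧸ I) h
    exact IsTensorExact.extension hd S.subtype_injective (LinearMap.exact_subtype_mkQ S)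
      S.mkQ_surjective h1 h2

/-- Tensor exactness passes from the residue field of a maximal ideal to all torsion modules. -/
lemma IsTensorExact.of_torsion [∀ n, Module.Flat A (P n)]
    (hd : ∀ n, Function.Exact (d (n + 1)) (d n)) {I : Ideal A} [hI : I.IsMaximal]
    (h : IsTensorExact d (A ⧸ I)) (hN : ∀ x : N, ∃ k : ℕ, ∀ r ∈ I ^ k, r • x = 0) :
    IsTensorExact d N := by
  refine isTensorExact_of_forall N hd fun n x hx => ?_
  -- A single tensor involves only a finitely generated submodule S, which one power of I
  -- annihilates; flatness keeps x a cycle over S.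
  obtain ⟨S, hS, hxS⟩ := TensorProduct.exists_finite_submodule_left_of_setFinite {x}
    (Set.finite_singleton x)
  obtain ⟨y, rfl⟩ := Set.singleton_subset_iff.mp hxS
  obtain ⟨k, hk⟩ : ∃ k : ℕ, ∀ r ∈ I ^ k, ∀ x : S, r • x = 0 := by
    obtain ⟨s, hs⟩ := Module.Finite.iff_fg.mp hS
    choose k hk using hN
    refine ⟨s.sup k, fun r hr x => Subtype.ext ?_⟩
    obtain ⟨x, hx⟩ := x
    change r • x = 0
    rw [← hs] at hx
    refine Submodule.span_induction (fun x hx => ?_) (smul_zero r) (fun x y _ _ hx hy => ?_)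
      (fun a x _ hx => ?_) hx
    · exact hk x r (Ideal.pow_le_pow_right (Finset.le_sup (f := k) hx) hr)
    · rw [smul_add, hx, hy, add_zero]
    · rw [smul_comm, hx, smul_zero]
  obtain ⟨z, rfl⟩ := (IsTensorExact.of_pow_smul_eq_zero hd h k hk n y).mp (by
    refine Module.Flat.rTensor_preserves_injective_linearMap (M := P n) S.subtype
      S.subtype_injective ?_
    rw [← lTensor_rTensor_comm, hx, map_zero])
  exact ⟨S.subtype.rTensor _ z, lTensor_rTensor_comm _ _ _⟩

end TensorExact

/-! ### Adic flatness from regular pairs -/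

section RegularPair

variable {A : Type u} [CommRing A]

lemma rTensor_lsmul_injective {M : Type*} [AddCommGroup M] [Module A M] {a : A}
    (h : ∀ m : M, a • m = 0 → m = 0) :
    Function.Injective ((LinearMap.lsmul A A a).rTensor M) := by
  refine (injective_iff_map_eq_zero _).mpr fun x hx => ?_
  obtain ⟨m, rfl⟩ := (TensorProduct.lid A M).symm.surjective x
  have h1 := congrArg (TensorProduct.lid A M) hx
  rw [TensorProduct.lid_symm_apply, LinearMap.rTensor_tmul, map_zero, TensorProduct.lid_tmul,
    LinearMap.lsmul_apply, smul_eq_mul, mul_one] at h1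
  rw [h m h1, map_zero]

/-- After A ⧸ (a) ⊗ M = M ⧸ aM, the map is multiplication by b on M ⧸ aM. -/
lemma rTensor_lsmul_quotient_injective {M : Type*} [AddCommGroup M] [Module A M] {a b : A}
    (h : ∀ m m' : M, b • m = a • m' → ∃ z, m = a • z) :
    Function.Injective ((LinearMap.lsmul A (A ⧸ Ideal.span {a}) b).rTensor M) := by
  refine (injective_iff_map_eq_zero _).mpr fun x hx => ?_
  obtain ⟨m, rfl⟩ := (TensorProduct.quotTensorEquivQuotSMul M (Ideal.span {a})).symm.surjective x
  obtain ⟨m, rfl⟩ := Submodule.Quotient.mk_surjective _ m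
  have h1 := congrArg (TensorProduct.quotTensorEquivQuotSMul M (Ideal.span {a})) hx
  rw [TensorProduct.quotTensorEquivQuotSMul_symm_mk, LinearMap.rTensor_tmul, map_zero,
    LinearMap.lsmul_apply, TensorProduct.smul_tmul,
    TensorProduct.quotTensorEquivQuotSMul_mk_one_tmul, Submodule.Quotient.mk_eq_zero,
    Submodule.ideal_span_singleton_smul, Submodule.mem_smul_pointwise_iff_exists] at h1
  obtain ⟨m', -, hm'⟩ := h1
  obtain ⟨z, rfl⟩ := h m m' hm'.symm
  rw [(Submodule.Quotient.mk_eq_zero _).mpr, map_zero]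
  rw [Submodule.ideal_span_singleton_smul]
  exact Submodule.smul_mem_pointwise_smul _ _ _ Submodule.mem_top

/-- If `(a, b)` is regular both on `A` and on `M` then tensoring with `A ⧸ (a, b)` preserves the
exactness of flat resolutions of `M`. -/
lemma isTensorExact_quotient_span_pair {P : ℕ → Type*} [∀ n, AddCommGroup (P n)]
    [∀ n, Module A (P n)] [∀ n, Module.Flat A (P n)] {d : ∀ n, P (n + 1) →ₗ[A] P n}
    (hd : ∀ n, Function.Exact (d (n + 1)) (d n))
    {M : Type*} [AddCommGroup M] [Module A M] {ε : P 0 →ₗ[A] M} (hε : Function.Surjective ε)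
    (hdε : Function.Exact (d 0) ε) {a b : A} (h0 : ∀ x, a * x = 0 → x = 0)
    (h1 : ∀ x y, b * x = a * y → ∃ z, x = a * z) (hM0 : ∀ m : M, a • m = 0 → m = 0)
    (hM1 : ∀ m m' : M, b • m = a • m' → ∃ z, m = a • z) :
    IsTensorExact d (A ⧸ (Ideal.span {a, b} : Ideal A)) := by
  have hA : IsTensorExact d A := isTensorExact_of_flat hd A
  have hAa : IsTensorExact d (A ⧸ Ideal.span {a}) := by
    refine IsTensorExact.quotient (i := LinearMap.lsmul A A a) (p := (Ideal.span {a}).mkQ) hd hε hdε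
      ((injective_iff_map_eq_zero _).mpr h0) (fun x => ?_) (Submodule.mkQ_surjective _)
      (rTensor_lsmul_injective hM0) hA hA
    rw [Submodule.mkQ_apply, Submodule.Quotient.mk_eq_zero, Ideal.mem_span_singleton]
    exact ⟨fun ⟨y, hy⟩ => ⟨y, hy.symm⟩, fun ⟨y, hy⟩ => ⟨y, hy.symm⟩⟩
  have hle : Ideal.span {a} ≤ Ideal.span {a, b} := Ideal.span_mono (by simp)
  refine IsTensorExact.quotient (i := LinearMap.lsmul A (A ⧸ Ideal.span {a}) b)
    (p := Submodule.factor hle) hd hε hdε ?_ ?_ (Submodule.factor_surjective hle)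
    (rTensor_lsmul_quotient_injective hM1) hAa hAa
  · refine (injective_iff_map_eq_zero _).mpr fun x hx => ?_
    obtain ⟨x, rfl⟩ := Submodule.Quotient.mk_surjective _ x
    rw [LinearMap.lsmul_apply, ← Submodule.Quotient.mk_smul, Submodule.Quotient.mk_eq_zero,
      Ideal.mem_span_singleton] at hx
    obtain ⟨y, hy⟩ := hx
    obtain ⟨z, rfl⟩ := h1 x y hy
    exact (Submodule.Quotient.mk_eq_zero _).mpr (Ideal.mem_span_singleton.mpr ⟨z, rfl⟩)
  · intro x
    obtain ⟨x, rfl⟩ := Submodule.Quotient.mk_surjective _ x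
    change (Submodule.Quotient.mk x : A ⧸ (Ideal.span {a, b} : Ideal A)) = 0 ↔ _
    rw [Submodule.Quotient.mk_eq_zero, Ideal.mem_span_pair]
    constructor
    · rintro ⟨r, s, rfl⟩
      refine ⟨Submodule.Quotient.mk s, ?_⟩
      rw [LinearMap.lsmul_apply, ← Submodule.Quotient.mk_smul, Submodule.Quotient.eq,
        Ideal.mem_span_singleton]
      exact ⟨-r, by rw [smul_eq_mul]; ring⟩
    · rintro ⟨y, hy⟩
      obtain ⟨y, rfl⟩ := Submodule.Quotient.mk_surjective _ y
      rw [LinearMap.lsmul_apply, ← Submodule.Quotient.mk_smul, Submodule.Quotient.eq,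
        Ideal.mem_span_singleton] at hy
      obtain ⟨z, hz⟩ := hy
      exact ⟨-z, y, by rw [smul_eq_mul] at hz; linear_combination hz⟩

section Resolution

variable {M : ModuleCat.{u} A} (R : ProjectiveResolution M)

instance flat_complex_X (n : ℕ) : Module.Flat A (R.complex.X n) := by
  have := R.projective n
  have : Module.Projective A (R.complex.X n) := (IsProjective.iff_projective _).mpr this
  infer_instance

/-- The differentials of a projective resolution. -/
def resolutionD (n : ℕ) : R.complex.X (n + 1) →ₗ[A] R.complex.X n := (R.complex.d (n + 1) n).hom

/-- The augmentation of a projective resolution. -/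
def resolutionAug : R.complex.X 0 →ₗ[A] M := (R.π.f 0).hom

lemma resolutionD_exact (n : ℕ) : Function.Exact (resolutionD R (n + 1)) (resolutionD R n) :=
  (ShortComplex.ShortExact.moduleCat_exact_iff_function_exact _).mp (R.exact_succ n)

lemma resolutionAug_surjective : Function.Surjective (resolutionAug R) :=
  (ModuleCat.epi_iff_surjective (R.π.f 0)).mp inferInstance

lemma resolutionAug_exact : Function.Exact (resolutionD R 0) (resolutionAug R) :=
  (ShortComplex.ShortExact.moduleCat_exact_iff_function_exact _).mp R.exact₀

/-- `Tor` is derived in its second variable, so it is computed from a resolution of M. -/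
lemma isZero_Tor_of_isTensorExact {N : ModuleCat.{u} A}
    (h : IsTensorExact (P := fun n => R.complex.X n) (resolutionD R) N) (i : ℕ) :
    Limits.IsZero (((Tor (ModuleCat.{u} A) (i + 1)).obj N).obj M) := by
  refine Limits.IsZero.of_iso ?_ (R.isoLeftDerivedObj _ (i + 1))
  change Limits.IsZero (HomologicalComplex.homology _ (i + 1))
  rw [← HomologicalComplex.exactAt_iff_isZero_homology,
    HomologicalComplex.exactAt_iff' _ (i + 2) (i + 1) i (by simp) (by simp),
    ShortComplex.ShortExact.moduleCat_exact_iff_function_exact]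
  exact h i

end Resolution

/-- A module is adically flat for a maximal ideal generated by two elements that form a regular
sequence both on the ring and on the module. -/
lemma isAdicallyFlat_span_pair {a b : A} (hI : (Ideal.span {a, b} : Ideal A).IsMaximal)
    (h0 : ∀ x, a * x = 0 → x = 0) (h1 : ∀ x y, b * x = a * y → ∃ z, x = a * z)
    {M : Type u} [AddCommGroup M] [Module A M] (hM0 : ∀ m : M, a • m = 0 → m = 0)
    (hM1 : ∀ m m' : M, b • m = a • m' → ∃ z, m = a • z) :
    IsAdicallyFlat (Ideal.span {a, b}) M := by
  intro N hN i hi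
  obtain ⟨i, rfl⟩ := Nat.exists_eq_succ_of_ne_zero hi.ne'
  let R := projectiveResolution (ModuleCat.of A M)
  have hquot : IsTensorExact (P := fun n => R.complex.X n) (resolutionD R)
      (A ⧸ (Ideal.span {a, b} : Ideal A)) :=
    isTensorExact_quotient_span_pair (P := fun n => R.complex.X n) (d := resolutionD R)
      (resolutionD_exact R) (M := M) (ε := resolutionAug R) (resolutionAug_surjective R)
      (resolutionAug_exact R) h0 h1 hM0 hM1
  exact isZero_Tor_of_isTensorExact R
    (IsTensorExact.of_torsion (P := fun n => R.complex.X n) (d := resolutionD R)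
      (resolutionD_exact R) hquot hN) i

end RegularPair

/-! ### The completion is adically flat -/

section AdicallyFlat

open PowerSeries (X)

variable {K : Type u} [Field K]

lemma isMaximal_varIdeal : (varIdeal K).IsMaximal := by
  let φ : TensorPow K →+* K := (MvPowerSeries.constantCoeff).comp (toMv K).toRingHom
  have hφ : Function.Surjective φ := fun c =>
    ⟨algebraMap K _ c, by
      change MvPowerSeries.constantCoeff (toMv K (algebraMap K _ c)) = c
      rw [AlgHom.commutes]
      exact MvPowerSeries.constantCoeff_C _⟩
  have h : varIdeal K = RingHom.ker φ := by
    ext a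
    refine ((congrArg (a ∈ ·) (pow_one (varIdeal K))).to_iff.symm.trans
      (mem_varIdeal_pow_iff 1 a)).trans ?_
    rw [RingHom.mem_ker]
    constructor
    · exact fun h => h 0 (by simp)
    · intro h m hm
      obtain rfl : m = 0 := by rw [← Finsupp.degree_eq_zero_iff]; omega
      exact h
  rw [h]
  exact RingHom.ker_isMaximal_of_surjective φ hφ

lemma isAdicallyFlat_span_pair_algebra {A : Type u} [CommRing A] {a b : A}
    (hI : (Ideal.span {a, b} : Ideal A).IsMaximal)
    (h0 : ∀ x, a * x = 0 → x = 0) (h1 : ∀ x y, b * x = a * y → ∃ z, x = a * z)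
    {M : Type u} [CommRing M] [Algebra A M] (hM0 : ∀ m, algebraMap A M a * m = 0 → m = 0)
    (hM1 : ∀ m m', algebraMap A M b * m = algebraMap A M a * m' →
      ∃ z, m = algebraMap A M a * z) :
    IsAdicallyFlat (Ideal.span {a, b}) M := by
  simp only [← Algebra.smul_def] at hM0 hM1
  exact isAdicallyFlat_span_pair hI h0 h1 hM0 hM1

lemma X_zero_ne_zero : (MvPowerSeries.X 0 : MvPowerSeries (Fin 2) K) ≠ 0 := fun h => by
  have h1 := congrArg (MvPowerSeries.coeff (Finsupp.single 0 1)) h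
  rw [MvPowerSeries.coeff_index_single_self_X, map_zero] at h1
  exact one_ne_zero h1

lemma exists_eq_X_zero_mul (p q : MvPowerSeries (Fin 2) K)
    (h : MvPowerSeries.X 1 * p = MvPowerSeries.X 0 * q) : ∃ r, p = MvPowerSeries.X 0 * r := by
  refine MvPowerSeries.X_dvd_iff.mpr fun m hm => ?_
  -- The coefficient of p at m reappears in X₁ p at m + (0, 1), still on the axis m 0 = 0, where X₀
  -- q has none.
  have h1 := congrArg (MvPowerSeries.coeff (m + Finsupp.single 1 1)) h
  rw [coeff_X_mul_eq_ite, coeff_X_mul_eq_ite] at h1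
  simpa [hm] using h1

lemma isAdicallyFlat_completion :
    IsAdicallyFlat (varIdeal K) (AdicCompletion (varIdeal K) (TensorPow K)) := by
  refine isAdicallyFlat_span_pair_algebra (isMaximal_varIdeal (K := K)) (X_tmul_one_mul_injective K)
    (exists_eq_X_tmul_one_mul K) (fun m hm => ?_) fun m m' hm => ?_
  · have h := congrArg (completionEquiv K) hm
    rw [map_mul, completionEquiv_algebraMap, map_zero, toMv_X_left, mul_eq_zero] at h
    exact (map_eq_zero_iff _ (completionEquiv K).injective).mp (h.resolve_left X_zero_ne_zero)
  · have h := congrArg (completionEquiv K) hm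
    rw [map_mul, map_mul, completionEquiv_algebraMap, completionEquiv_algebraMap, toMv_X_left,
      toMv_X_right] at h
    obtain ⟨r, hr⟩ := exists_eq_X_zero_mul _ _ h
    refine ⟨(completionEquiv K).symm r, (completionEquiv K).injective ?_⟩
    rw [hr, map_mul, completionEquiv_algebraMap, toMv_X_left, AlgEquiv.apply_symm_apply]

end AdicallyFlat

end

end AdicFlatness

open AdicFlatness in
theorem theorem6p2 (K : Type u) [Field K] [CharZero K] :
    -- the ideal `(t₁, t₂)` is weakly proregular
    IsWeaklyProregular (varIdeal K) ∧
    -- `A` is not noetherian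
    ¬ IsNoetherianRing (TensorPow K) ∧
    -- the completion is `K⟦t₁, t₂⟧`, and the image of `f ⊗ g` in it is `f(t₁) g(t₂)`
    (∃ e : AdicCompletion (varIdeal K) (TensorPow K) ≃ₐ[K] MvPowerSeries (Fin 2) K,
      ∀ (f g : PowerSeries K) (m : Fin 2 →₀ ℕ),
        MvPowerSeries.coeff m
            (e (algebraMap (TensorPow K) (AdicCompletion (varIdeal K) (TensorPow K))
              (f ⊗ₜ[K] g))) =
          PowerSeries.coeff (m 0) f * PowerSeries.coeff (m 1) g) ∧
    -- the completion is noetherian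
    IsNoetherianRing (AdicCompletion (varIdeal K) (TensorPow K)) ∧
    -- the completion is adically flat over `A`, but not flat
    IsAdicallyFlat (varIdeal K) (AdicCompletion (varIdeal K) (TensorPow K)) ∧
    ¬ Module.Flat (TensorPow K) (AdicCompletion (varIdeal K) (TensorPow K)) ∧
    -- `I / I ^ 2` is isomorphic to the module of Kähler differentials of `K⟦t⟧` over `K`
    (∃ e : (diagIdeal K).Cotangent ≃+ KaehlerDifferential K (PowerSeries K),
      ∀ (x : TensorPow K) (y : (diagIdeal K).Cotangent),
        e (x • y) = Algebra.TensorProduct.lmul' K (S := PowerSeries K) x • e y) ∧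
    -- which is not finitely generated
    ¬ Module.Finite (PowerSeries K) (KaehlerDifferential K (PowerSeries K)) :=
  ⟨isWeaklyProregular_varIdeal K, not_isNoetherianRing_tensorPow K,
    ⟨completionEquiv K, fun f g m => by rw [completionEquiv_algebraMap]; rfl⟩, inferInstance,
    isAdicallyFlat_completion, not_flat_completion,
    ⟨cotangentEquiv K, cotangentEquiv_smul K⟩, not_finite_kaehlerDifferential K⟩
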